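/- Theorem. A \emph{Peano curve} is a continuous map $\gamma : I \to \mathbb{R}^2$ on a nondegenerate interval $I \subseteq \mathbb{R}$ whose image has nonempty interior. A \emph{continuous line field} on an open set $U \subseteq \mathbb{R}^2$ assigns to each $p \in U$ a one-dimensional linear subspace $\Lambda(p) \subset \mathbb{R}^2$ that depends continuously on $p$, i.e. that is locally spanned by a continuous nowhere vanishing vector field. Let $\mathbb{T} = \mathbb{R}/2\pi\mathbb{Z}$. For a $C^\infty$ map $f : \mathbb{T} \to \mathbb{R}^2$, regarded as a $2\pi$-periodic map on $\mathbb{R}$, and $k \in \mathbb{N} = \{0,1,2,\dots\}$, let $\|f\|_k = \max_{0 \le j \le k} \sup_{\theta} \|f^{(j)}(\theta)\|$, with the Euclidean norm on $\mathbb{R}^2$. For $t>0$ let $\alpha_t : \mathbb{T} \to \mathbb{R}^2$, $\alpha_t(\theta) = (t\cos\theta, t\sin\theta)$. (1) There exist a Peano curve $\gamma : [0,\infty) \to \mathbb{R}^2$ and a continuous line field $\Lambda$ on $\mathbb{R}^2 \setminus \{\gamma(0)\}$ such that, for every $t>0$, the boundary $C_t = \partial\,\gamma([0,t])$ contains $\gamma(t)$,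 is contained in $\mathbb{R}^2 \setminus \{\gamma(0)\}$, and is a $C^\infty$ closed curve (the image of a $C^\infty$ embedding of $\mathbb{T}$ into $\mathbb{R}^2$) whose tangent line at each point $p \in C_t$ is $\Lambda(p)$. (2) Moreover, given any upper semicontinuous function $k : (0,\infty) \to \mathbb{N}$ and any lower semicontinuous function $\varepsilon : (0,\infty) \to (0,\infty)$, one can choose $\gamma$ and $\Lambda$ as in (1) with the following additional property: for every $t>0$, the curve $C_t$ is the image of a $C^\infty$ embedding $\beta_t : \mathbb{T} \to \mathbb{R}^2$ such that $$\|\beta_t - \alpha_t\|_{k(t)} < \varepsilon(t).$$ -/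

import Mathlib

open Set Filter Topology
open scoped ContDiff

/-- The Euclidean plane `ℝ²`. -/
abbrev Plane : Type := EuclideanSpace ℝ (Fin 2)

/-- A Peano curve on a nondegenerate interval `I ⊆ ℝ`: a continuous map `γ : I → ℝ²` whose image
has nonempty interior. (Only the values of `γ` on `I` matter.) -/
structure IsPeanoCurveOn (I : Set ℝ) (γ : ℝ → Plane) : Prop where
  isInterval : I.OrdConnected
  nondegenerate : I.Nontrivial
  continuousOn : ContinuousOn γ I
  interior_nonempty : (interior (γ '' I)).Nonempty

/-- The footprint `γ([0,t])`. -/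
def footprint (γ : ℝ → Plane) (t : ℝ) : Set Plane := γ '' Icc 0 t

/-- A continuous line field on `U ⊆ ℝ²`: an assignment of a line `Λ p` through the origin of `ℝ²`
to each point `p` of `U`, which near every point of `U` is spanned by a continuous
nowhere vanishing vector field. (Only the values of `Λ` on `U` matter.) -/
def IsContinuousLineFieldOn (U : Set Plane) (Λ : Plane → Submodule ℝ Plane) : Prop :=
  ∀ p ∈ U, ∃ V : Set Plane, IsOpen V ∧ p ∈ V ∧ ∃ v : Plane → Plane,
    ContinuousOn v (V ∩ U) ∧ ∀ q ∈ V ∩ U, v q ≠ 0 ∧ Λ q = Submodule.span ℝ {v q}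

/-- A map on the circle `ℝ/2πℤ` (which is `Real.Angle`), regarded as a `2π`-periodic map on `ℝ`. -/
noncomputable def periodicLift (β : Real.Angle → Plane) : ℝ → Plane := fun x => β (x : Real.Angle)

/-- `β` is a `C^∞` embedding of the circle `ℝ/2πℤ` into the plane: a `C^∞` immersion that is a
homeomorphism onto its image. -/
structure IsSmoothCircleEmbedding (β : Real.Angle → Plane) : Prop where
  contDiff : ContDiff ℝ ∞ (periodicLift β)
  deriv_ne_zero : ∀ x : ℝ, deriv (periodicLift β) x ≠ 0
  isEmbedding : Topology.IsEmbedding β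

/-- The `C^k` norm `max_{j ≤ k} sup_x ‖f^{(j)}(x)‖` of a (smooth) map on the circle `ℝ/2πℤ`.
All these suprema are finite when `f` is smooth. -/
noncomputable def ckNorm (k : ℕ) (f : Real.Angle → Plane) : ℝ :=
  (Finset.range (k + 1)).sup' Finset.nonempty_range_add_one
    fun j => ⨆ x : ℝ, ‖iteratedDeriv j (periodicLift f) x‖

/-- The standard parametrization `θ ↦ (t cos θ, t sin θ)` of the circle of radius `t`. -/
noncomputable def circleParam (t : ℝ) : Real.Angle → Plane :=
  fun θ => !₂[t * θ.cos, t * θ.sin]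

/-- `β` parametrizes `C` as a `C^∞` closed curve in the punctured plane `ℝ² ∖ {o}` that is tangent
at each of its points to the line field `Λ`: `β` is a `C^∞` embedding of the circle with image `C`,
its image avoids `o`, and the tangent line of `β` at each parameter is the line of `Λ`. -/
structure ParametrizesTangentCurve (o : Plane) (Λ : Plane → Submodule ℝ Plane) (C : Set Plane)
    (β : Real.Angle → Plane) : Prop where
  isSmoothCircleEmbedding : IsSmoothCircleEmbedding β
  range_eq : range β = C
  ne_puncture : ∀ θ : Real.Angle, β θ ≠ o
  tangent : ∀ x : ℝ, Submodule.span ℝ {deriv (periodicLift β) x} = Λ (periodicLift β x)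

/-!
The curves `C_t` are written in polar coordinates as `r = u θ t`, and the moving point sits at the
angle `φ t` on the curve of time `t`. If `u` is increasing in `t`, jointly continuous together with
its `θ`-derivative, and if `u θ` is locally constant at every time `t` at which `φ t` is not the
angle `θ`, then everything follows (`IsRadialGrowth`). Indeed the height in the direction `θ`
first reaches the value `r` at a time when the moving point is at that very place
(`IsRadialGrowth.exists_time`), so the footprint of time `t` is the full star-shaped region below
`u · t`. Two curves that meet do not cross, hence are tangent
(`IsRadialGrowth.slope_eq_of_radius_eq`); so the tangent direction is a function of the point, and
it is continuous because the parameters `(θ, t)` of a compact annulus range over a compact set.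

Such a growth is the occupation density (local time) of a very irregular path on the circle. The
path is a sum of binary digits of `x ∈ ℝ` with weights `weight m = 2π / 2 ^ ⌊√m⌋` (`digitSum`).
Let `I_n(x)` be the integral of `exp (-i n digitSum)` over `[0, x]`. Splitting `[0, x]` into
dyadic cells bounds `I_n(x)` by the Fourier transforms of the cells, which are products of
cosines. As every weight `2π / 2 ^ l` is repeated about `2l` times, powers of Viète's product occur
in them, so `I_n(x)` decays faster than any power of `n`, uniformly in `x`
(`exists_norm_occupationCoeff_le`). The density of the occupation measure of `[0, x]` is thus a
smooth function of the angle. Its Abel means are integrals of Poisson kernels, which shows that it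
increases with `x` and changes only at the angles visited by the path
(`occupationDensity_mono`, `occupationDensity_eq_of_cos_le`). Since `I_n(1) = 0` for `n ≥ 1`, a
unit of `x` adds exactly the constant `1`.

The digit sum jumps at dyadic rationals. It becomes continuous after a gap in time is inserted at
every dyadic rational: `x` is placed at the time `dyadicJump x = ∑ 4⁻ᵐ ⌊2ᵐ x⌋`, at which the `m`-th
digit of `x` is the value of a continuous periodic function at `4ᵐ` times that time
(`movingAngle_dyadicJump`); during the gaps the point moves along the curve, which stands still.
The curves of integer time `j` in the resulting model (`modelHeight`) are the constants `j`.

Finally the layer between consecutive integers of the model is mapped affinely to a thin layer of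
the punctured plane. All derivatives of the model curves are bounded, so a layer of thickness `h`
contains only curves within `O(h)` of the circles in each `C^k` norm. Since `k` and `1 / ε` are
locally bounded above, a locally finite choice of thin enough layers exists
(`exists_piecewise_affine_orderIso`).
-/


/-! ### Weighted sums of binary digits -/

/-- The first binary digit (after the point) of a real number, as a real number. -/
noncomputable def binaryDigit (y : ℝ) : ℝ := ((⌊2 * y⌋ - 2 * ⌊y⌋ : ℤ) : ℝ)

/-- The sum of `w m` over the indices `m` for which the `m`-th binary digit of `x` is `1`. -/
noncomputable def digitSum (w : ℕ → ℝ) (x : ℝ) : ℝ := ∑' m, w m * binaryDigit (2 ^ m * x)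

lemma binaryDigit_add_intCast (y : ℝ) (j : ℤ) : binaryDigit (y + j) = binaryDigit y := by
  unfold binaryDigit
  have : 2 * (y + j) = 2 * y + ((2 * j : ℤ) : ℝ) := by push_cast; ring
  rw [this, Int.floor_add_intCast, Int.floor_add_intCast]
  congr 1; ring

lemma binaryDigit_of_lt_half {y : ℝ} (h0 : 0 ≤ y) (h1 : y < 1 / 2) : binaryDigit y = 0 := by
  unfold binaryDigit
  have a : ⌊y⌋ = 0 := Int.floor_eq_iff.2 ⟨by simpa using h0, by norm_num; linarith⟩
  have b : ⌊2 * y⌋ = 0 := Int.floor_eq_iff.2 ⟨by norm_num; linarith, by norm_num; linarith⟩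
  simp [a, b]

lemma binaryDigit_of_half_le {y : ℝ} (h0 : 1 / 2 ≤ y) (h1 : y < 1) : binaryDigit y = 1 := by
  unfold binaryDigit
  have a : ⌊y⌋ = 0 := Int.floor_eq_iff.2 ⟨by norm_num; linarith, by norm_num; linarith⟩
  have b : ⌊2 * y⌋ = 1 := Int.floor_eq_iff.2 ⟨by norm_num; linarith, by norm_num; linarith⟩
  simp [a, b]

lemma binaryDigit_eq_zero_or_one (y : ℝ) : binaryDigit y = 0 ∨ binaryDigit y = 1 := by
  have h : binaryDigit y = binaryDigit (Int.fract y) := by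
    conv_lhs => rw [← Int.fract_add_floor y, binaryDigit_add_intCast]
  rw [h]
  rcases lt_or_ge (Int.fract y) (1 / 2) with h' | h'
  · exact Or.inl (binaryDigit_of_lt_half (Int.fract_nonneg y) h')
  · exact Or.inr (binaryDigit_of_half_le h' (Int.fract_lt_one y))

lemma abs_binaryDigit_le (y : ℝ) : |binaryDigit y| ≤ 1 := by
  rcases binaryDigit_eq_zero_or_one y with h | h <;> simp [h]

lemma summable_digitSum {w : ℕ → ℝ} (hw : Summable fun m => |w m|) (x : ℝ) :
    Summable fun m => w m * binaryDigit (2 ^ m * x) := by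
  refine Summable.of_norm_bounded hw fun m => ?_
  rw [norm_mul]
  exact mul_le_of_le_one_right (abs_nonneg _) (abs_binaryDigit_le _)

lemma measurable_digitSum (w : ℕ → ℝ) : Measurable (digitSum w) := by
  unfold digitSum
  refine Measurable.tsum fun m => ?_
  have : Measurable binaryDigit := by
    unfold binaryDigit
    have h1 : Measurable fun y : ℝ => ⌊2 * y⌋ := Int.measurable_floor.comp (measurable_const_mul 2)
    have h2 : Measurable fun y : ℝ => ⌊y⌋ := Int.measurable_floor
    exact (measurable_of_countable (fun z : ℤ => (z : ℝ))).comp (h1.sub (h2.const_mul 2))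
  exact (this.comp (measurable_const_mul _)).const_mul _

lemma digitSum_add_one (w : ℕ → ℝ) (x : ℝ) : digitSum w (x + 1) = digitSum w x := by
  unfold digitSum
  congr 1; ext m
  have : (2 : ℝ) ^ m * (x + 1) = 2 ^ m * x + ((2 ^ m : ℤ) : ℝ) := by push_cast; ring
  rw [this, binaryDigit_add_intCast]

lemma digitSum_eq_add {w : ℕ → ℝ} (hw : Summable fun m => |w m|) (x : ℝ) :
    digitSum w x = w 0 * binaryDigit x + digitSum (fun m => w (m + 1)) (2 * x) := by
  unfold digitSum
  rw [(summable_digitSum hw x).tsum_eq_zero_add]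
  simp only [pow_zero, one_mul]
  congr 2; ext m
  rw [pow_succ, mul_assoc]

/-! ### Fourier integrals of digit sums -/

/-- The Fourier integral at frequency `n` of the occupation measure of `digitSum w` on
`[0, x]`. -/
noncomputable def occupationCoeff (w : ℕ → ℝ) (n : ℕ) (x : ℝ) : ℂ :=
  ∫ s in (0 : ℝ)..x, Complex.exp (-(Complex.I * n * digitSum w s))

lemma norm_exp_neg_I_mul (n : ℕ) (a : ℝ) : ‖Complex.exp (-(Complex.I * n * a))‖ = 1 := by
  have : -(Complex.I * n * a) = ((-(n * a) : ℝ) : ℂ) * Complex.I := by push_cast; ring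
  rw [this, Complex.norm_exp_ofReal_mul_I]

lemma measurable_exp_digitSum (w : ℕ → ℝ) (n : ℕ) :
    Measurable fun s => Complex.exp (-(Complex.I * n * digitSum w s)) := by
  have := measurable_digitSum w
  fun_prop

lemma intervalIntegrable_exp_digitSum (w : ℕ → ℝ) (n : ℕ) (a b : ℝ) :
    IntervalIntegrable (fun s => Complex.exp (-(Complex.I * n * digitSum w s)))
      MeasureTheory.volume a b := by
  refine (intervalIntegrable_const (c := (1 : ℝ))).mono_fun
    (measurable_exp_digitSum w n).aestronglyMeasurable ?_
  refine Eventually.of_forall fun s => ?_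
  simp [norm_exp_neg_I_mul]

lemma norm_occupationCoeff_le (w : ℕ → ℝ) (n : ℕ) (x : ℝ) : ‖occupationCoeff w n x‖ ≤ |x| := by
  have := intervalIntegral.norm_integral_le_of_norm_le_const (a := 0) (b := x) (C := 1)
    (f := fun s => Complex.exp (-(Complex.I * n * digitSum w s)))
    (fun s _ => (norm_exp_neg_I_mul n _).le)
  simpa [occupationCoeff] using this

/-- The integral over the left half of `[0, 1]`, where the leading digit is `0`. -/
lemma occupationCoeff_left {w : ℕ → ℝ} (hw : Summable fun m => |w m|) (n : ℕ) {x : ℝ}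
    (h0 : 0 ≤ x) (h1 : x ≤ 1 / 2) :
    occupationCoeff w n x = (1 / 2) * occupationCoeff (fun m => w (m + 1)) n (2 * x) := by
  have key : occupationCoeff w n x = ∫ s in (0 : ℝ)..x,
      (fun y => Complex.exp (-(Complex.I * n * digitSum (fun m => w (m + 1)) y))) (2 * s) := by
    unfold occupationCoeff
    refine intervalIntegral.integral_congr_uIoo fun s hs => ?_
    rw [uIoo_of_le h0] at hs
    simp only
    rw [digitSum_eq_add hw, binaryDigit_of_lt_half hs.1.le (by linarith [hs.2])]
    simp
  rw [key, intervalIntegral.integral_comp_mul_left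
    (fun y => Complex.exp (-(Complex.I * n * digitSum (fun m => w (m + 1)) y))) (two_ne_zero)]
  simp [occupationCoeff]

/-- The integral over the right half of `[0, 1]`, where the leading digit is `1`. -/
lemma occupationCoeff_right {w : ℕ → ℝ} (hw : Summable fun m => |w m|) (n : ℕ) {x : ℝ}
    (h0 : 1 / 2 ≤ x) (h1 : x ≤ 1) :
    occupationCoeff w n x = (1 / 2) * occupationCoeff (fun m => w (m + 1)) n 1 +
      (1 / 2) * Complex.exp (-(Complex.I * n * w 0)) *
        occupationCoeff (fun m => w (m + 1)) n (2 * x - 1) := by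
  have split : occupationCoeff w n x = occupationCoeff w n (1 / 2) +
      ∫ s in (1 / 2 : ℝ)..x, Complex.exp (-(Complex.I * n * digitSum w s)) := by
    unfold occupationCoeff
    rw [intervalIntegral.integral_add_adjacent_intervals
      (intervalIntegrable_exp_digitSum w n _ _) (intervalIntegrable_exp_digitSum w n _ _)]
  have key : (∫ s in (1 / 2 : ℝ)..x, Complex.exp (-(Complex.I * n * digitSum w s))) =
      ∫ s in (1 / 2 : ℝ)..x, Complex.exp (-(Complex.I * n * w 0)) *
      (fun y => Complex.exp (-(Complex.I * n * digitSum (fun m => w (m + 1)) y)))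
        (2 * s + (-1)) := by
    refine intervalIntegral.integral_congr_uIoo fun s hs => ?_
    rw [uIoo_of_le h0] at hs
    simp only
    have hper := digitSum_add_one (fun m => w (m + 1)) (2 * s + (-1))
    rw [neg_add_cancel_right] at hper
    rw [digitSum_eq_add hw, binaryDigit_of_half_le hs.1.le (by linarith [hs.2]), hper,
      ← Complex.exp_add]
    congr 1; push_cast; ring
  rw [split, key, occupationCoeff_left hw n (by norm_num) le_rfl,
    intervalIntegral.integral_const_mul, intervalIntegral.integral_comp_mul_add
      (fun y => Complex.exp (-(Complex.I * n * digitSum (fun m => w (m + 1)) y))) (two_ne_zero)]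
  have e1 : (2 : ℝ) * (1 / 2) + -1 = 0 := by norm_num
  have e2 : (2 : ℝ) * (1 / 2) = 1 := by norm_num
  rw [e1, e2]
  simp only [occupationCoeff, Complex.real_smul, ← sub_eq_add_neg]
  push_cast
  ring

/-- Over the whole of `[0, 1]` the digits are independent, and each contributes a cosine factor. -/
lemma norm_occupationCoeff_one {w : ℕ → ℝ} (hw : Summable fun m => |w m|) (n : ℕ) :
    ‖occupationCoeff w n 1‖ =
      |Real.cos (n * w 0 / 2)| * ‖occupationCoeff (fun m => w (m + 1)) n 1‖ := by
  rw [occupationCoeff_right hw n (by norm_num) le_rfl]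
  have e2 : (2 : ℝ) * 1 - 1 = 1 := by norm_num
  rw [e2]
  have : (1 / 2 : ℂ) * occupationCoeff (fun m => w (m + 1)) n 1 +
      (1 / 2) * Complex.exp (-(Complex.I * n * w 0)) * occupationCoeff (fun m => w (m + 1)) n 1 =
      Complex.exp (((-(n * w 0 / 2) : ℝ) : ℂ) * Complex.I) * ((Real.cos (n * w 0 / 2) : ℝ) : ℂ) *
        occupationCoeff (fun m => w (m + 1)) n 1 := by
    have hc : Complex.exp (((-(n * w 0 / 2) : ℝ) : ℂ) * Complex.I) *
        ((Real.cos (n * w 0 / 2) : ℝ) : ℂ) =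
        1 / 2 + 1 / 2 * Complex.exp (-(Complex.I * n * w 0)) := by
      rw [Complex.ofReal_cos, Complex.cos, mul_div_assoc', mul_add, ← Complex.exp_add,
        ← Complex.exp_add]
      have a1 : ((-(n * w 0 / 2) : ℝ) : ℂ) * Complex.I + ((n * w 0 / 2 : ℝ) : ℂ) * Complex.I
        = 0 := by push_cast; ring
      have a2 : ((-(n * w 0 / 2) : ℝ) : ℂ) * Complex.I + -((n * w 0 / 2 : ℝ) : ℂ) * Complex.I
        = -(Complex.I * n * w 0) := by push_cast; ring
      rw [a1, a2, Complex.exp_zero]; ring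
    rw [hc]; ring
  rw [this, norm_mul, norm_mul, Complex.norm_exp_ofReal_mul_I, one_mul, Complex.norm_real,
    Real.norm_eq_abs]

/-- An integral over `[0, x]` is controlled by the integrals over the dyadic cells into which
`[0, x]` decomposes, one of each length. -/
lemma norm_occupationCoeff_le_sum (n N : ℕ) : ∀ {w : ℕ → ℝ}, (Summable fun m => |w m|) →
    ∀ {x : ℝ}, 0 ≤ x → x ≤ 1 → ‖occupationCoeff w n x‖ ≤
      ∑ j ∈ Finset.range N, (1 / 2) ^ (j + 1) * ‖occupationCoeff (fun m => w (m + (j + 1))) n 1‖ +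
        (1 / 2) ^ N := by
  induction N with
  | zero =>
    intro w hw x h0 h1
    have := norm_occupationCoeff_le w n x
    rw [abs_of_nonneg h0] at this
    simpa using this.trans h1
  | succ N ih =>
    intro w hw x h0 h1
    have hw' : Summable fun m => |w (m + 1)| := (summable_nat_add_iff 1).2 hw
    have half : ‖(1 / 2 : ℂ)‖ = 1 / 2 := by norm_num
    have shift : ∀ j, (fun m => w (m + (j + 1) + 1)) = fun m => w (m + (j + 1 + 1)) := fun j => rfl
    have step : ∀ {y : ℝ}, 0 ≤ y → y ≤ 1 →
        (1 / 2) * ‖occupationCoeff (fun m => w (m + 1)) n y‖ ≤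
        ∑ j ∈ Finset.range N, (1 / 2) ^ (j + 1 + 1) *
          ‖occupationCoeff (fun m => w (m + (j + 1 + 1))) n 1‖ + (1 / 2) ^ (N + 1) := by
      intro y hy0 hy1
      have := ih hw' hy0 hy1
      calc _ ≤ 1 / 2 * (_ + (1 / 2) ^ N) := mul_le_mul_of_nonneg_left this (by norm_num)
        _ = _ := by
          rw [mul_add, Finset.mul_sum]
          congr 1
          · refine Finset.sum_congr rfl fun j _ => ?_
            rw [pow_succ _ (j + 1)]
            simp only [shift]; ring
          · ring
    rw [Finset.sum_range_succ']
    rcases le_total x (1 / 2) with hx | hx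
    · rw [occupationCoeff_left hw n h0 hx, norm_mul, half]
      have := step (y := 2 * x) (by linarith) (by linarith)
      have : 0 ≤ (1 / 2 : ℝ) ^ (0 + 1) * ‖occupationCoeff (fun m => w (m + (0 + 1))) n 1‖ := by
        positivity
      linarith
    · rw [occupationCoeff_right hw n hx h1]
      refine (norm_add_le _ _).trans ?_
      rw [norm_mul, norm_mul, norm_mul, half, norm_exp_neg_I_mul, mul_one]
      have := step (y := 2 * x - 1) (by linarith) (by linarith)
      simp only [zero_add, pow_one]
      linarith

/-! ### Rapid decay of the Fourier integrals -/

/-- The digit weights: the weight `2π / 2 ^ l` is used for the `2l + 1` indices `m` in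
`[l², (l + 1)²)`. The repetition makes the occupation density smooth. -/
noncomputable def weight (m : ℕ) : ℝ := 2 * Real.pi / 2 ^ Nat.sqrt m

lemma weight_nonneg (m : ℕ) : 0 ≤ weight m := by unfold weight; positivity

lemma succ_pow_four_le (s : ℕ) : (s + 1) ^ 4 ≤ 384 * 2 ^ s := by
  have h1 := Nat.pow_sub_le_descFactorial (s + 4) 4
  have h2 := Nat.choose_le_two_pow (s + 4) 4
  rw [Nat.descFactorial_eq_factorial_mul_choose] at h1
  have h3 : s + 4 + 1 - 4 = s + 1 := by omega
  have h4 : Nat.factorial 4 = 24 := rfl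
  rw [h3, h4] at h1
  calc _ ≤ _ := h1
    _ ≤ 24 * 2 ^ (s + 4) := Nat.mul_le_mul_left _ h2
    _ = _ := by ring

/-- The weight `2π / 2 ^ √m` is `O(1 / (m + 1)²)`. -/
lemma summable_weight : Summable weight := by
  have hs : Summable fun m : ℕ => 2 * Real.pi * 384 * (1 / ((m + 1 : ℕ) : ℝ) ^ 2) :=
    ((summable_nat_add_iff 1).2 (Real.summable_one_div_nat_pow.2 one_lt_two)).mul_left _
  refine Summable.of_nonneg_of_le weight_nonneg (fun m => ?_) hs
  have h1 : (m + 1) ^ 2 ≤ 384 * 2 ^ Nat.sqrt m := by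
    refine le_trans ?_ (succ_pow_four_le _)
    have : m + 1 ≤ (Nat.sqrt m + 1) ^ 2 := by rw [sq]; exact Nat.succ_le_succ_sqrt m
    calc (m + 1) ^ 2 ≤ ((Nat.sqrt m + 1) ^ 2) ^ 2 := Nat.pow_le_pow_left this 2
      _ = _ := by ring
  have h2 : ((m + 1 : ℕ) : ℝ) ^ 2 ≤ 384 * 2 ^ Nat.sqrt m := by exact_mod_cast h1
  unfold weight
  rw [mul_assoc, div_eq_mul_inv]
  refine mul_le_mul_of_nonneg_left ?_ (by positivity)
  rw [mul_one_div, inv_eq_one_div, div_le_div_iff₀ (by positivity) (by positivity)]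
  linarith

lemma summable_abs_weight_add (k : ℕ) : Summable fun m => |weight (m + k)| := by
  simp only [abs_of_nonneg (weight_nonneg _)]
  exact (summable_nat_add_iff k).2 summable_weight

lemma summable_abs_weight : Summable fun m => |weight m| := summable_abs_weight_add 0

/-- The absolute value of the Fourier transform, at frequency `n`, of the occupation density of
a dyadic cell of generation `k`. -/
noncomputable def cellDecay (n k : ℕ) : ℝ := ‖occupationCoeff (fun m => weight (m + k)) n 1‖

lemma cellDecay_nonneg (n k : ℕ) : 0 ≤ cellDecay n k := norm_nonneg _

lemma cellDecay_le_one (n k : ℕ) : cellDecay n k ≤ 1 := by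
  simpa [cellDecay] using norm_occupationCoeff_le (fun m => weight (m + k)) n 1

lemma cellDecay_eq (n k : ℕ) :
    cellDecay n k = |Real.cos (Real.pi * n / 2 ^ Nat.sqrt k)| * cellDecay n (k + 1) := by
  unfold cellDecay
  rw [norm_occupationCoeff_one (summable_abs_weight_add k)]
  have h1 : (n : ℝ) * weight (0 + k) / 2 = Real.pi * n / 2 ^ Nat.sqrt k := by
    unfold weight; rw [zero_add]; ring
  have h2 : (fun m => weight (m + 1 + k)) = fun m => weight (m + (k + 1)) := by
    ext m; congr 1; omega
  rw [h1, h2]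

lemma cellDecay_mono (n : ℕ) : Monotone (cellDecay n) := by
  refine monotone_nat_of_le_succ fun k => ?_
  rw [cellDecay_eq]
  exact mul_le_of_le_one_left (cellDecay_nonneg _ _) (Real.abs_cos_le_one _)

lemma cellDecay_sq_le (n l i : ℕ) (hi : i ≤ 2 * l + 1) :
    cellDecay n (l ^ 2) ≤ |Real.cos (Real.pi * n / 2 ^ l)| ^ i * cellDecay n (l ^ 2 + i) := by
  induction i with
  | zero => simp
  | succ i ih =>
    refine (ih (by omega)).trans (le_of_eq ?_)
    have : Nat.sqrt (l ^ 2 + i) = l := by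
      rw [sq]; exact Nat.sqrt_add_eq l (by omega)
    rw [cellDecay_eq, this, pow_succ]
    ring_nf

lemma cellDecay_sq_le_pow (n l p : ℕ) (hp : p ≤ 2 * l + 1) :
    cellDecay n (l ^ 2) ≤ |Real.cos (Real.pi * n / 2 ^ l)| ^ p * cellDecay n ((l + 1) ^ 2) := by
  have h := cellDecay_sq_le n l (2 * l + 1) le_rfl
  have e : l ^ 2 + (2 * l + 1) = (l + 1) ^ 2 := by ring
  rw [e] at h
  refine h.trans (mul_le_mul_of_nonneg_right ?_ (cellDecay_nonneg _ _))
  exact pow_le_pow_of_le_one (abs_nonneg _) (Real.abs_cos_le_one _) hp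

/-- The levels from `a` on, each occurring at least `p` times, contribute the `p`-th power of the
product of one cosine per level. -/
lemma cellDecay_sq_le_prod (n a p d : ℕ) (hp : p ≤ a) :
    cellDecay n (a ^ 2) ≤ (∏ i ∈ Finset.range d, |Real.cos (Real.pi * n / 2 ^ (a + i))|) ^ p := by
  suffices cellDecay n (a ^ 2) ≤
      (∏ i ∈ Finset.range d, |Real.cos (Real.pi * n / 2 ^ (a + i))|) ^ p *
        cellDecay n ((a + d) ^ 2) from
    this.trans (mul_le_of_le_one_right (by positivity) (cellDecay_le_one _ _))
  induction d with
  | zero => simp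
  | succ d ih =>
    refine ih.trans ?_
    rw [Finset.prod_range_succ, mul_pow, mul_assoc]
    exact mul_le_mul_of_nonneg_left (cellDecay_sq_le_pow n (a + d) p (by omega)) (by positivity)

/-- Viète's product formula. -/
lemma abs_sin_eq_prod_cos (y : ℝ) (a d : ℕ) :
    |Real.sin (y / 2 ^ a)| = 2 ^ d * (∏ i ∈ Finset.range d, |Real.cos (y / 2 ^ (a + 1 + i))|) *
      |Real.sin (y / 2 ^ (a + d))| := by
  induction d with
  | zero => simp
  | succ d ih =>
    have h : y / 2 ^ (a + d) = 2 * (y / 2 ^ (a + 1 + d)) := by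
      have : (2 : ℝ) ^ (a + 1 + d) = 2 * 2 ^ (a + d) := by ring
      rw [this]; field_simp
    rw [ih, Finset.prod_range_succ, h, Real.sin_two_mul, abs_mul, abs_mul, abs_two,
      show a + (d + 1) = a + 1 + d by ring]
    ring

/-- Viète's product of cosines is at most `2 ^ a / n` once its last angle is at most `π / 2`, by
Jordan's inequality for the last sine. -/
lemma prod_abs_cos_le (n a d : ℕ) (hn : 1 ≤ n) (hd : 2 * n ≤ 2 ^ (a + d)) :
    ∏ i ∈ Finset.range d, |Real.cos (Real.pi * n / 2 ^ (a + 1 + i))| ≤ 2 ^ a / n := by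
  have hd' : 2 * (n : ℝ) ≤ 2 ^ (a + d) := by exact_mod_cast hd
  have hn' : (1 : ℝ) ≤ n := by exact_mod_cast hn
  have hpi := Real.pi_pos
  have h1 := abs_sin_eq_prod_cos (Real.pi * n) a d
  have h2 : 2 / Real.pi * (Real.pi * n / 2 ^ (a + d)) ≤ Real.sin (Real.pi * n / 2 ^ (a + d)) := by
    refine Real.mul_le_sin (by positivity) ?_
    rw [div_le_div_iff₀ (by positivity) two_pos]
    nlinarith
  have h3 : 2 / Real.pi * (Real.pi * n / 2 ^ (a + d)) = 2 * n / 2 ^ (a + d) := by field_simp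
  rw [h3] at h2
  set P := ∏ i ∈ Finset.range d, |Real.cos (Real.pi * n / 2 ^ (a + 1 + i))| with hP
  have hP0 : 0 ≤ P := Finset.prod_nonneg fun _ _ => abs_nonneg _
  have h4 : 2 ^ d * P * (2 * n / 2 ^ (a + d)) ≤ 1 := by
    refine le_trans ?_ (Real.abs_sin_le_one (Real.pi * n / 2 ^ a))
    rw [h1]
    exact mul_le_mul_of_nonneg_left (h2.trans (le_abs_self _)) (by positivity)
  have h5 : 2 ^ d * P * (2 * n / 2 ^ (a + d)) = P * (2 * n) / 2 ^ a := by
    rw [pow_add]; field_simp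
  rw [h5, div_le_one (by positivity)] at h4
  rw [le_div_iff₀ (by positivity)]
  nlinarith

/-- The cells of generation `k` decay at every polynomial rate, with a constant that grows only
subexponentially in `k`; the lengths `2 ^ (-k)` of the cells compensate for that growth. -/
lemma cellDecay_le (n k p : ℕ) (hn : 1 ≤ n) :
    cellDecay n k ≤ 2 ^ p ^ 2 * 2 ^ (p * Nat.sqrt k) / n ^ p := by
  -- All levels above `a` occur after the index `k`, and each occurs at least `p` times.
  set a := p + Nat.sqrt k
  have hk : k ≤ (a + 1) ^ 2 := by
    have h1 : k < (Nat.sqrt k + 1) ^ 2 := by rw [sq]; exact Nat.lt_succ_sqrt k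
    exact h1.le.trans (Nat.pow_le_pow_left (by omega) 2)
  have h2 := (cellDecay_mono n hk).trans (cellDecay_sq_le_prod n (a + 1) p (2 * n) (by omega))
  have h3 : 2 * n ≤ 2 ^ (a + 2 * n) :=
    (Nat.lt_two_pow_self).le.trans (Nat.pow_le_pow_right two_pos (by omega))
  refine (h2.trans (pow_le_pow_left₀ (Finset.prod_nonneg fun _ _ => abs_nonneg _)
    (prod_abs_cos_le n a (2 * n) hn h3) p)).trans (le_of_eq ?_)
  rw [div_pow, ← pow_mul, ← pow_add]
  congr 2
  simp only [a]; ring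

/-- At a nonzero integer frequency, some digit weight makes the cosine factor vanish: the
occupation measure of the whole unit interval is uniform on the circle. -/
lemma occupationCoeff_weight_one (n : ℕ) (hn : 1 ≤ n) : occupationCoeff weight n 1 = 0 := by
  -- For `n = 2 ^ a * b` with `b` odd, the weight `2π / 2 ^ (a + 1)` gives the factor `cos (π b / 2)`.
  obtain ⟨a, b, hb, rfl⟩ := Nat.exists_eq_two_pow_mul_odd (n := n) (by omega)
  have h := (cellDecay_mono (2 ^ a * b) (Nat.zero_le ((a + 1) ^ 2))).trans
    (cellDecay_sq_le_pow (2 ^ a * b) (a + 1) 1 (by omega))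
  have hc : Real.cos (Real.pi * (2 ^ a * b : ℕ) / 2 ^ (a + 1)) = 0 := by
    obtain ⟨c, rfl⟩ := hb
    rw [Real.cos_eq_zero_iff]
    refine ⟨c, ?_⟩
    push_cast
    rw [pow_succ]; field_simp
  rw [hc] at h
  simp only [abs_zero, pow_one, zero_mul] at h
  exact norm_le_zero_iff.1 h

lemma summable_two_pow_mul_sqrt (p : ℕ) :
    Summable fun j : ℕ => (1 / 2 : ℝ) ^ j * 2 ^ (p * Nat.sqrt j) := by
  have hg : Summable fun j : ℕ => √(2 ^ p ^ 2) * √(1 / 2) ^ j := by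
    refine (summable_geometric_of_lt_one (Real.sqrt_nonneg _) ?_).mul_left _
    rw [Real.sqrt_lt' one_pos]; norm_num
  refine Summable.of_nonneg_of_le (fun j => by positivity) (fun j => ?_) hg
  refine le_of_sq_le_sq ?_ (by positivity)
  rw [mul_pow, mul_pow, Real.sq_sqrt (by positivity), ← pow_mul (√(1 / 2)), mul_comm j 2,
    pow_mul (√(1 / 2)), Real.sq_sqrt (by positivity), ← pow_mul, ← pow_mul]
  have h1 : Nat.sqrt j ^ 2 ≤ j := Nat.sqrt_le' j
  -- The geometric mean of `p²` and `j` bounds `p √j`.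
  have h2 : p * Nat.sqrt j * 2 ≤ p ^ 2 + j := by
    zify at h1 ⊢
    nlinarith [sq_nonneg ((p : ℤ) - Nat.sqrt j)]
  have h3 : (2 : ℝ) ^ (p * Nat.sqrt j * 2) ≤ 2 ^ (p ^ 2 + j) :=
    pow_le_pow_right₀ one_le_two h2
  calc (1 / 2 : ℝ) ^ (j * 2) * 2 ^ (p * Nat.sqrt j * 2)
      ≤ (1 / 2 : ℝ) ^ (j * 2) * 2 ^ (p ^ 2 + j) := mul_le_mul_of_nonneg_left h3 (by positivity)
    _ = 2 ^ p ^ 2 * (1 / 2) ^ j := by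
      rw [pow_add, mul_comm j 2, two_mul, pow_add, one_div, inv_pow]
      field_simp

lemma exists_norm_occupationCoeff_le_of_mem_Icc (p : ℕ) : ∃ C : ℝ, 0 ≤ C ∧ ∀ n : ℕ, 1 ≤ n →
    ∀ x : ℝ, 0 ≤ x → x ≤ 1 → ‖occupationCoeff weight n x‖ ≤ C / n ^ p := by
  have hs := (summable_nat_add_iff 1).2 (summable_two_pow_mul_sqrt p)
  set S := ∑' j : ℕ, (1 / 2 : ℝ) ^ (j + 1) * 2 ^ (p * Nat.sqrt (j + 1))
  have hS : 0 ≤ S := tsum_nonneg fun j => by positivity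
  refine ⟨2 ^ p ^ 2 * S, by positivity, fun n hn x h0 h1 => ?_⟩
  have hn' : (0 : ℝ) < n := by exact_mod_cast hn
  have bound : ∀ N : ℕ, ‖occupationCoeff weight n x‖ ≤ 2 ^ p ^ 2 * S / n ^ p + (1 / 2) ^ N := by
    intro N
    refine (norm_occupationCoeff_le_sum n N summable_abs_weight h0 h1).trans ?_
    gcongr
    calc ∑ j ∈ Finset.range N, (1 / 2 : ℝ) ^ (j + 1) * cellDecay n (j + 1)
        ≤ ∑ j ∈ Finset.range N, 2 ^ p ^ 2 / (n : ℝ) ^ p *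
          ((1 / 2 : ℝ) ^ (j + 1) * 2 ^ (p * Nat.sqrt (j + 1))) := by
          refine Finset.sum_le_sum fun j _ => ?_
          calc _ ≤ (1 / 2) ^ (j + 1) * (2 ^ p ^ 2 * 2 ^ (p * Nat.sqrt (j + 1)) / (n : ℝ) ^ p) :=
              mul_le_mul_of_nonneg_left (cellDecay_le n (j + 1) p hn) (by positivity)
            _ = _ := by ring
      _ ≤ 2 ^ p ^ 2 / (n : ℝ) ^ p * S := by
          rw [← Finset.mul_sum]
          refine mul_le_mul_of_nonneg_left ?_ (by positivity)
          exact hs.sum_le_tsum _ fun j _ => by positivity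
      _ = _ := by ring
  have lim : Tendsto (fun N : ℕ => 2 ^ p ^ 2 * S / n ^ p + (1 / 2 : ℝ) ^ N) atTop
      (𝓝 (2 ^ p ^ 2 * S / n ^ p + 0)) :=
    tendsto_const_nhds.add (tendsto_pow_atTop_nhds_zero_of_lt_one (by norm_num) (by norm_num))
  rw [add_zero] at lim
  exact ge_of_tendsto' lim bound

lemma occupationCoeff_add_one (n : ℕ) (hn : 1 ≤ n) (x : ℝ) :
    occupationCoeff weight n (x + 1) = occupationCoeff weight n x := by
  have hper : Function.Periodic
      (fun s => Complex.exp (-(Complex.I * n * digitSum weight s))) 1 := by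
    intro s; simp only [digitSum_add_one]
  have h := occupationCoeff_weight_one n hn
  unfold occupationCoeff at h ⊢
  rw [← intervalIntegral.integral_add_adjacent_intervals
    (intervalIntegrable_exp_digitSum weight n 0 x)
    (intervalIntegrable_exp_digitSum weight n x (x + 1)), hper.intervalIntegral_add_eq x 0,
    zero_add, h, add_zero]

lemma occupationCoeff_fract (n : ℕ) (hn : 1 ≤ n) (x : ℝ) :
    occupationCoeff weight n (Int.fract x) = occupationCoeff weight n x := by
  have hper : Function.Periodic (occupationCoeff weight n) 1 := occupationCoeff_add_one n hn
  have := hper.sub_int_mul_eq ⌊x⌋ (x := x)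
  rwa [mul_one] at this

lemma occupationCoeff_intCast (n : ℕ) (hn : 1 ≤ n) (j : ℤ) :
    occupationCoeff weight n j = 0 := by
  rw [← occupationCoeff_fract n hn, Int.fract_intCast]
  simp [occupationCoeff]

/-- The Fourier integrals decay faster than every power of the frequency, uniformly in the
end point. -/
lemma exists_norm_occupationCoeff_le (p : ℕ) : ∃ C : ℝ, 0 ≤ C ∧ ∀ n : ℕ, 1 ≤ n →
    ∀ x : ℝ, ‖occupationCoeff weight n x‖ ≤ C / n ^ p := by
  obtain ⟨C, hC, h⟩ := exists_norm_occupationCoeff_le_of_mem_Icc p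
  refine ⟨C, hC, fun n hn x => ?_⟩
  rw [← occupationCoeff_fract n hn]
  exact h n hn _ (Int.fract_nonneg x) (Int.fract_lt_one x).le

lemma continuous_occupationCoeff (w : ℕ → ℝ) (n : ℕ) : Continuous (occupationCoeff w n) :=
  intervalIntegral.continuous_primitive (fun a b => intervalIntegrable_exp_digitSum w n a b) 0

/-! ### The occupation density -/

/-- The real trigonometric monomial `θ ↦ Re (c e^{inθ})`. -/
noncomputable def wave (n : ℕ) (c : ℂ) (θ : ℝ) : ℝ := (c * Complex.exp (Complex.I * n * θ)).re

lemma norm_exp_I_mul (n : ℕ) (a : ℝ) : ‖Complex.exp (Complex.I * n * a)‖ = 1 := by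
  have : Complex.I * n * a = ((n * a : ℝ) : ℂ) * Complex.I := by push_cast; ring
  rw [this, Complex.norm_exp_ofReal_mul_I]

lemma abs_wave_le (n : ℕ) (c : ℂ) (θ : ℝ) : |wave n c θ| ≤ ‖c‖ := by
  refine (Complex.abs_re_le_norm _).trans ?_
  rw [norm_mul, norm_exp_I_mul, mul_one]

lemma hasDerivAt_wave (n : ℕ) (c : ℂ) (θ : ℝ) :
    HasDerivAt (wave n c) (wave n (c * (Complex.I * n)) θ) θ := by
  have h1 : HasDerivAt (fun y : ℝ => Complex.I * n * (y : ℂ)) (Complex.I * n) θ := by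
    simpa using (Complex.ofRealCLM.hasDerivAt (x := θ)).const_mul (Complex.I * n)
  have h2 := (h1.cexp).const_mul c
  have h3 := Complex.reCLM.hasFDerivAt.comp_hasDerivAt θ h2
  refine HasDerivAt.congr_deriv h3 (Eq.symm ?_)
  change (c * (Complex.I * n) * Complex.exp (Complex.I * n * θ)).re =
    (c * (Complex.exp (Complex.I * n * θ) * (Complex.I * n))).re
  congr 1; ring

lemma contDiff_wave (n : ℕ) (c : ℂ) : ContDiff ℝ ∞ (wave n c) := by
  unfold wave
  have : ContDiff ℝ ∞ fun y : ℝ => c * Complex.exp (Complex.I * n * (y : ℂ)) :=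
    contDiff_const.mul ((contDiff_const.mul Complex.ofRealCLM.contDiff).cexp)
  exact Complex.reCLM.contDiff.comp this

lemma iteratedDeriv_wave (n : ℕ) (k : ℕ) : ∀ c : ℂ,
    iteratedDeriv k (wave n c) = wave n (c * (Complex.I * n) ^ k) := by
  induction k with
  | zero => intro c; simp
  | succ k ih =>
    intro c
    have : deriv (wave n c) = wave n (c * (Complex.I * n)) :=
      funext fun θ => (hasDerivAt_wave n c θ).deriv
    rw [iteratedDeriv_succ', this, ih]
    congr 1; ring

lemma norm_iteratedFDeriv_wave_le (n k : ℕ) (c : ℂ) (θ : ℝ) :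
    ‖iteratedFDeriv ℝ k (wave n c) θ‖ ≤ (n : ℝ) ^ k * ‖c‖ := by
  rw [norm_iteratedFDeriv_eq_norm_iteratedDeriv, iteratedDeriv_wave, Real.norm_eq_abs]
  refine (abs_wave_le _ _ _).trans (le_of_eq ?_)
  simp [norm_pow, mul_comm]

/-- The oscillating part of the occupation density. -/
noncomputable def densityWave (θ x : ℝ) : ℝ :=
  ∑' n : ℕ, wave (n + 1) (2 * occupationCoeff weight (n + 1) x) θ

/-- The derivative in `θ` of the occupation density. -/
noncomputable def densityWaveDeriv (θ x : ℝ) : ℝ :=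
  ∑' n : ℕ, wave (n + 1)
    (2 * occupationCoeff weight (n + 1) x * (Complex.I * (n + 1 : ℕ))) θ

/-- The density at the angle `θ`, with respect to `dθ / 2π`, of the occupation measure of the
digit sum on `[0, x]`, as a Fourier series. -/
noncomputable def occupationDensity (θ x : ℝ) : ℝ := x + densityWave θ x

lemma exists_summable_bound (k : ℕ) : ∃ v : ℕ → ℝ, Summable v ∧ ∀ (n : ℕ) (x : ℝ),
    ((n + 1 : ℕ) : ℝ) ^ k * ‖2 * occupationCoeff weight (n + 1) x‖ ≤ v n := by
  obtain ⟨C, hC, h⟩ := exists_norm_occupationCoeff_le (k + 2)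
  refine ⟨fun n => 2 * C * (1 / ((n + 1 : ℕ) : ℝ) ^ 2),
    ((summable_nat_add_iff 1).2 (Real.summable_one_div_nat_pow.2 one_lt_two)).mul_left _,
    fun n x => ?_⟩
  have h1 := h (n + 1) (by omega) x
  have hn : (0 : ℝ) < ((n + 1 : ℕ) : ℝ) := by positivity
  rw [norm_mul, Complex.norm_ofNat]
  calc _ ≤ ((n + 1 : ℕ) : ℝ) ^ k * (2 * (C / ((n + 1 : ℕ) : ℝ) ^ (k + 2))) := by gcongr
    _ = _ := by rw [pow_add]; field_simp

lemma exists_summable_bound_iteratedFDeriv : ∃ v : ℕ → ℕ → ℝ, (∀ k, Summable (v k)) ∧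
    ∀ (k n : ℕ) (θ x : ℝ), ‖iteratedFDeriv ℝ k
      (wave (n + 1) (2 * occupationCoeff weight (n + 1) x)) θ‖ ≤ v k n := by
  choose v hv h using exists_summable_bound
  exact ⟨v, hv, fun k n θ x => (norm_iteratedFDeriv_wave_le _ _ _ _).trans (h k n x)⟩

lemma contDiff_densityWave (x : ℝ) : ContDiff ℝ ∞ fun θ => densityWave θ x := by
  obtain ⟨v, hv, h⟩ := exists_summable_bound_iteratedFDeriv
  exact contDiff_tsum (N := ⊤) (fun n => contDiff_wave _ _) (fun k _ => hv k)
    fun k n θ _ => h k n θ x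

lemma exists_norm_iteratedFDeriv_densityWave_le : ∃ E : ℕ → ℝ, ∀ (k : ℕ) (θ x : ℝ),
    ‖iteratedFDeriv ℝ k (fun θ => densityWave θ x) θ‖ ≤ E k := by
  obtain ⟨v, hv, h⟩ := exists_summable_bound_iteratedFDeriv
  refine ⟨fun k => ∑' n, v k n, fun k θ x => ?_⟩
  unfold densityWave
  rw [iteratedFDeriv_tsum (N := ⊤) (fun n => contDiff_wave _ _) (fun k _ => hv k)
    (fun k n θ _ => h k n θ x) (by exact_mod_cast le_top)]
  exact tsum_of_norm_bounded (hv k).hasSum fun n => h k n θ x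

lemma continuous_wave (n : ℕ) : Continuous fun q : ℂ × ℝ => wave n q.1 q.2 := by
  unfold wave; fun_prop

lemma continuous_densityWave : Continuous fun q : ℝ × ℝ => densityWave q.1 q.2 := by
  obtain ⟨v, hv, h⟩ := exists_summable_bound 0
  refine continuous_tsum (fun n => ?_) hv fun n q => ?_
  · have := continuous_occupationCoeff weight (n + 1)
    exact (continuous_wave (n + 1)).comp (by fun_prop :
      Continuous fun q : ℝ × ℝ => (2 * occupationCoeff weight (n + 1) q.2, q.1))
  · refine (abs_wave_le _ _ _).trans ?_
    simpa using h n q.2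

lemma continuous_densityWaveDeriv : Continuous fun q : ℝ × ℝ => densityWaveDeriv q.1 q.2 := by
  obtain ⟨v, hv, h⟩ := exists_summable_bound 1
  refine continuous_tsum (fun n => ?_) hv fun n q => ?_
  · have := continuous_occupationCoeff weight (n + 1)
    exact (continuous_wave (n + 1)).comp (by fun_prop : Continuous fun q : ℝ × ℝ =>
      (2 * occupationCoeff weight (n + 1) q.2 * (Complex.I * (n + 1 : ℕ)), q.1))
  · refine (abs_wave_le _ _ _).trans (le_trans (le_of_eq ?_) (h n q.2))
    rw [norm_mul _ (Complex.I * _), norm_mul Complex.I, Complex.norm_I, Complex.norm_natCast]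
    ring

lemma summable_wave (θ x : ℝ) :
    Summable fun n : ℕ => wave (n + 1) (2 * occupationCoeff weight (n + 1) x) θ := by
  obtain ⟨v, hv, h⟩ := exists_summable_bound 0
  exact Summable.of_norm_bounded hv fun n =>
    (abs_wave_le _ _ _).trans (by simpa using h n x)

lemma hasDerivAt_densityWave (θ x : ℝ) :
    HasDerivAt (fun θ => densityWave θ x) (densityWaveDeriv θ x) θ := by
  obtain ⟨v, hv, h⟩ := exists_summable_bound 1
  refine hasDerivAt_tsum hv (fun n y => hasDerivAt_wave _ _ y) (fun n y => ?_)
    (summable_wave 0 x) θ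
  refine (abs_wave_le _ _ _).trans (le_trans (le_of_eq ?_) (h n x))
  rw [norm_mul _ (Complex.I * _), norm_mul Complex.I, Complex.norm_I, Complex.norm_natCast]
  ring

lemma densityWave_add_two_pi (θ x : ℝ) : densityWave (θ + 2 * Real.pi) x = densityWave θ x := by
  unfold densityWave wave
  congr 1; ext n
  congr 2
  have : Complex.I * (n + 1 : ℕ) * ((θ + 2 * Real.pi : ℝ) : ℂ) =
      Complex.I * (n + 1 : ℕ) * θ + (n + 1 : ℕ) * (2 * Real.pi * Complex.I) := by
    push_cast; ring
  rw [this, Complex.exp_add, Complex.exp_nat_mul_two_pi_mul_I, mul_one]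

lemma densityWave_intCast (θ : ℝ) (j : ℤ) : densityWave θ j = 0 := by
  unfold densityWave
  simp [occupationCoeff_intCast _ (Nat.succ_pos _), wave]

lemma densityWaveDeriv_intCast (θ : ℝ) (j : ℤ) : densityWaveDeriv θ j = 0 := by
  unfold densityWaveDeriv
  simp [occupationCoeff_intCast _ (Nat.succ_pos _), wave]

lemma occupationDensity_intCast (θ : ℝ) (j : ℤ) : occupationDensity θ j = j := by
  simp [occupationDensity, densityWave_intCast]

/-! ### Positivity and support of the occupation density -/

/-- The Poisson kernel of the disc, as a function of the angle. -/
noncomputable def poissonFactor (r α : ℝ) : ℝ :=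
  (1 - r ^ 2) / ((1 - r) ^ 2 + 2 * r * (1 - Real.cos α))

lemma hasSum_poissonFactor {r : ℝ} (h0 : 0 < r) (h1 : r < 1) (α : ℝ) :
    HasSum (fun n : ℕ => 2 * r ^ (n + 1) * Real.cos ((n + 1 : ℕ) * α))
      (poissonFactor r α - 1) := by
  set z : ℂ := r * Complex.exp (α * Complex.I) with hz
  have hzn : ‖z‖ < 1 := by
    rw [hz, norm_mul, Complex.norm_exp_ofReal_mul_I, mul_one, Complex.norm_real,
      Real.norm_of_nonneg h0.le]
    exact h1
  have hre : z.re = r * Real.cos α := by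
    rw [hz, Complex.exp_mul_I]; simp [← Complex.ofReal_cos, ← Complex.ofReal_sin]
  have him : z.im = r * Real.sin α := by
    rw [hz, Complex.exp_mul_I]; simp [← Complex.ofReal_cos, ← Complex.ofReal_sin]
  have hgeo := ((hasSum_geometric_of_norm_lt_one hzn).mul_left (2 * z))
  have hgeo' := Complex.hasSum_re hgeo
  have hden : Complex.normSq (1 - z) = (1 - r) ^ 2 + 2 * r * (1 - Real.cos α) := by
    rw [Complex.normSq_apply]
    simp only [Complex.sub_re, Complex.one_re, Complex.sub_im, Complex.one_im, hre, him]
    nlinarith [Real.sin_sq_add_cos_sq α]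
  have hpos : 0 < (1 - r) ^ 2 + 2 * r * (1 - Real.cos α) := by
    have := Real.cos_le_one α
    have : 0 < (1 - r) ^ 2 := by have : 0 < 1 - r := by linarith
                                 positivity
    nlinarith
  convert hgeo' using 1
  · ext n
    have : 2 * z * z ^ n = ((2 * r ^ (n + 1) : ℝ) : ℂ) *
        Complex.exp (((n + 1 : ℕ) * α : ℝ) * Complex.I) := by
      have e : (((n + 1 : ℕ) * α : ℝ) : ℂ) * Complex.I = (n + 1 : ℕ) * (α * Complex.I) := by
        push_cast; ring
      rw [e, Complex.exp_nat_mul, mul_assoc, ← pow_succ', hz, mul_pow]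
      push_cast; ring
    rw [this, Complex.re_ofReal_mul, Complex.exp_ofReal_mul_I_re]
  · rw [Complex.mul_re, Complex.inv_re, Complex.inv_im, hden]
    simp only [Complex.mul_re, Complex.mul_im, Complex.re_ofNat, Complex.im_ofNat,
      Complex.sub_re, Complex.sub_im, Complex.one_re, Complex.one_im, hre, him]
    have hs := Real.sin_sq_add_cos_sq α
    unfold poissonFactor
    rw [div_sub_one hpos.ne', mul_div_assoc', mul_div_assoc', ← sub_div]
    congr 1
    linear_combination (2 * r ^ 2) * hs

lemma poissonFactor_nonneg {r : ℝ} (h0 : 0 < r) (h1 : r < 1) (α : ℝ) :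
    0 ≤ poissonFactor r α := by
  have := Real.cos_le_one α
  unfold poissonFactor
  have : 0 ≤ 1 - r ^ 2 := by nlinarith
  have : 0 ≤ 2 * r * (1 - Real.cos α) := by
    have : 0 ≤ 1 - Real.cos α := by linarith
    positivity
  positivity

lemma poissonFactor_le {r δ α : ℝ} (h0 : 0 < r) (h1 : r < 1) (hδ : 0 < δ)
    (hα : Real.cos α ≤ 1 - δ) : poissonFactor r α ≤ (1 - r ^ 2) / (2 * r * δ) := by
  unfold poissonFactor
  have h : 0 ≤ 1 - r ^ 2 := by nlinarith
  refine div_le_div_of_nonneg_left h (by positivity) ?_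
  have h2 : 2 * r * δ ≤ 2 * r * (1 - Real.cos α) :=
    mul_le_mul_of_nonneg_left (by linarith) (by positivity)
  nlinarith [sq_nonneg (1 - r)]

lemma measurable_poissonFactor (r θ : ℝ) :
    Measurable fun s => poissonFactor r (θ - digitSum weight s) := by
  have := measurable_digitSum weight
  unfold poissonFactor
  fun_prop

/-- The Abel means of the Fourier series of the occupation density of `[x, y]` are its Poisson
integrals. -/
lemma integral_poissonFactor {r : ℝ} (h0 : 0 < r) (h1 : r < 1) (θ x y : ℝ) :
    ∫ s in x..y, poissonFactor r (θ - digitSum weight s) = (y - x) +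
      ∑' n : ℕ, r ^ (n + 1) * (wave (n + 1) (2 * occupationCoeff weight (n + 1) y) θ -
        wave (n + 1) (2 * occupationCoeff weight (n + 1) x) θ) := by
  have hbase : ∀ n : ℕ, (∫ s in x..y, 2 * r ^ (n + 1) *
      Real.cos ((n + 1 : ℕ) * (θ - digitSum weight s))) =
      r ^ (n + 1) * (wave (n + 1) (2 * occupationCoeff weight (n + 1) y) θ -
        wave (n + 1) (2 * occupationCoeff weight (n + 1) x) θ) := by
    intro n
    have hcos : ∀ s, 2 * r ^ (n + 1) * Real.cos ((n + 1 : ℕ) * (θ - digitSum weight s)) =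
        Complex.reCLM (2 * r ^ (n + 1) * Complex.exp (Complex.I * (n + 1 : ℕ) * θ) *
          Complex.exp (-(Complex.I * (n + 1 : ℕ) * digitSum weight s))) := by
      intro s
      have e : (2 * r ^ (n + 1) * Complex.exp (Complex.I * (n + 1 : ℕ) * θ) *
          Complex.exp (-(Complex.I * (n + 1 : ℕ) * digitSum weight s))) =
          ((2 * r ^ (n + 1) : ℝ) : ℂ) *
          Complex.exp (((n + 1 : ℕ) * (θ - digitSum weight s) : ℝ) * Complex.I) := by
        rw [mul_assoc, ← Complex.exp_add]; push_cast; congr 2; ring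
      rw [e, Complex.reCLM_apply, Complex.re_ofReal_mul, Complex.exp_ofReal_mul_I_re]
    simp_rw [hcos]
    rw [Complex.reCLM.intervalIntegral_comp_comm
      ((intervalIntegrable_exp_digitSum weight (n + 1) x y).const_mul _),
      intervalIntegral.integral_const_mul]
    have hsub : ∫ s in x..y, Complex.exp (-(Complex.I * (n + 1 : ℕ) * digitSum weight s)) =
        occupationCoeff weight (n + 1) y - occupationCoeff weight (n + 1) x := by
      unfold occupationCoeff
      rw [intervalIntegral.integral_interval_sub_left
        (intervalIntegrable_exp_digitSum weight (n + 1) 0 y)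
        (intervalIntegrable_exp_digitSum weight (n + 1) 0 x)]
    rw [hsub]
    unfold wave
    rw [← Complex.sub_re, ← Complex.re_ofReal_mul, Complex.reCLM_apply]
    congr 1
    push_cast; ring
  have hsum : HasSum (fun n : ℕ => ∫ s in x..y, 2 * r ^ (n + 1) *
      Real.cos ((n + 1 : ℕ) * (θ - digitSum weight s)))
      (∫ s in x..y, (poissonFactor r (θ - digitSum weight s) - 1)) := by
    have hm := measurable_digitSum weight
    refine intervalIntegral.hasSum_integral_of_dominated_convergence
      (fun n _ => 2 * r ^ (n + 1)) (fun n => ?_) (fun n => ?_) ?_ ?_ ?_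
    · exact Measurable.aestronglyMeasurable (by fun_prop)
    · refine Eventually.of_forall fun s _ => ?_
      rw [Real.norm_eq_abs, abs_mul, abs_of_pos (by positivity : 0 < 2 * r ^ (n + 1))]
      exact mul_le_of_le_one_right (by positivity) (Real.abs_cos_le_one _)
    · refine Eventually.of_forall fun s _ => ?_
      exact ((summable_nat_add_iff 1).2 (summable_geometric_of_lt_one h0.le h1)).mul_left 2
    · exact intervalIntegrable_const
    · exact Eventually.of_forall fun s _ => hasSum_poissonFactor h0 h1 _
  simp_rw [hbase] at hsum
  rw [hsum.tsum_eq]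
  have hint : IntervalIntegrable (fun s => poissonFactor r (θ - digitSum weight s))
      MeasureTheory.volume x y := by
    refine (intervalIntegrable_const (c := (1 - r ^ 2) / (1 - r) ^ 2)).mono_fun
      (measurable_poissonFactor r θ).aestronglyMeasurable (Eventually.of_forall fun s => ?_)
    have hp := poissonFactor_nonneg h0 h1 (θ - digitSum weight s)
    have hq : 0 ≤ 1 - r ^ 2 := by nlinarith
    have hr : 0 < 1 - r := by linarith
    simp only [Real.norm_eq_abs]
    rw [abs_of_nonneg hp, abs_of_nonneg (by positivity)]
    unfold poissonFactor
    refine div_le_div_of_nonneg_left hq (by positivity) ?_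
    have := Real.cos_le_one (θ - digitSum weight s)
    have : 0 ≤ 2 * r * (1 - Real.cos (θ - digitSum weight s)) :=
      mul_nonneg (by positivity) (by linarith)
    linarith
  rw [intervalIntegral.integral_sub hint intervalIntegrable_const]
  simp

/-- Abel summation of the Fourier series of the occupation density of `[x, y]`. -/
lemma tendsto_integral_poissonFactor (θ x y : ℝ) :
    Tendsto (fun r => ∫ s in x..y, poissonFactor r (θ - digitSum weight s)) (𝓝[<] 1)
      (𝓝 (occupationDensity θ y - occupationDensity θ x)) := by
  have hev : ∀ᶠ r : ℝ in 𝓝[<] 1, 0 < r ∧ r < 1 := Ioo_mem_nhdsLT zero_lt_one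
  set a : ℕ → ℝ := fun n => wave (n + 1) (2 * occupationCoeff weight (n + 1) y) θ -
        wave (n + 1) (2 * occupationCoeff weight (n + 1) x) θ with ha
  have hsa : Summable a := (summable_wave θ y).sub (summable_wave θ x)
  have hlim : Tendsto (fun r : ℝ => ∑' n, r ^ (n + 1) * a n) (𝓝[<] 1) (𝓝 (∑' n, a n)) := by
    refine tendsto_tsum_of_dominated_convergence hsa.norm (fun n => ?_) ?_
    · have : Tendsto (fun r : ℝ => r ^ (n + 1) * a n) (𝓝 1) (𝓝 (1 ^ (n + 1) * a n)) :=
        ((continuous_pow (n + 1)).tendsto 1).mul_const _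
      rw [one_pow, one_mul] at this
      exact this.mono_left nhdsWithin_le_nhds
    · filter_upwards [hev] with r hr n
      rw [norm_mul, norm_pow, Real.norm_of_nonneg hr.1.le]
      exact mul_le_of_le_one_left (norm_nonneg _) (pow_le_one₀ hr.1.le hr.2.le)
  have hval : occupationDensity θ y - occupationDensity θ x = (y - x) + ∑' n, a n := by
    unfold occupationDensity densityWave
    rw [ha, (summable_wave θ y).tsum_sub (summable_wave θ x)]; ring
  rw [hval]
  refine (tendsto_const_nhds.add hlim).congr' ?_
  filter_upwards [hev] with r hr
  exact (integral_poissonFactor hr.1 hr.2 θ x y).symm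

lemma occupationDensity_mono (θ : ℝ) : Monotone (occupationDensity θ) := by
  intro x y hxy
  have hev : ∀ᶠ r : ℝ in 𝓝[<] 1, 0 < r ∧ r < 1 := Ioo_mem_nhdsLT zero_lt_one
  refine sub_nonneg.1 (ge_of_tendsto (tendsto_integral_poissonFactor θ x y) ?_)
  filter_upwards [hev] with r hr
  exact intervalIntegral.integral_nonneg hxy fun s _ => poissonFactor_nonneg hr.1 hr.2 _

/-- The occupation density does not change at `θ` while the digit sum stays away from `θ`. -/
lemma occupationDensity_eq_of_cos_le {θ x y δ : ℝ} (hxy : x ≤ y) (hδ : 0 < δ)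
    (h : ∀ s ∈ Ioo x y, Real.cos (θ - digitSum weight s) ≤ 1 - δ) :
    occupationDensity θ x = occupationDensity θ y := by
  refine le_antisymm (occupationDensity_mono θ hxy) (sub_nonpos.1 ?_)
  have hev : ∀ᶠ r : ℝ in 𝓝[<] 1, 0 < r ∧ r < 1 := Ioo_mem_nhdsLT zero_lt_one
  have hlim : Tendsto (fun r : ℝ => (1 - r ^ 2) / (2 * r * δ) * |y - x|) (𝓝[<] 1) (𝓝 0) := by
    have : ContinuousAt (fun r : ℝ => (1 - r ^ 2) / (2 * r * δ) * |y - x|) 1 := by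
      refine ContinuousAt.mul (ContinuousAt.div (by fun_prop) (by fun_prop) ?_) (by fun_prop)
      positivity
    have h' : Tendsto _ _ _ := this
    norm_num at h'
    exact h'.mono_left nhdsWithin_le_nhds
  refine le_of_tendsto_of_tendsto (tendsto_integral_poissonFactor θ x y) hlim ?_
  filter_upwards [hev] with r hr
  refine (le_abs_self _).trans ?_
  rw [← Real.norm_eq_abs]
  refine intervalIntegral.norm_integral_le_of_norm_le_const_ae ?_
  have hy : ∀ᵐ s : ℝ, s ≠ y := by
    simp [MeasureTheory.ae_iff]
  filter_upwards [hy] with s hsy hs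
  rw [uIoc_of_le hxy] at hs
  rw [Real.norm_of_nonneg (poissonFactor_nonneg hr.1 hr.2 _)]
  exact poissonFactor_le hr.1 hr.2 hδ (h s ⟨hs.1, lt_of_le_of_ne hs.2 hsy⟩)

/-! ### Opening gaps in time -/

/-- A strictly increasing function that jumps at every dyadic rational. Its range has closure a
Cantor set; the jumps are the gaps of that set. -/
noncomputable def dyadicJump (x : ℝ) : ℝ := ∑' m : ℕ, (1 / 4 : ℝ) ^ (m + 1) * ⌊2 ^ (m + 1) * x⌋

lemma summable_dyadicJump (x : ℝ) :
    Summable fun m : ℕ => (1 / 4 : ℝ) ^ (m + 1) * ⌊2 ^ (m + 1) * x⌋ := by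
  have h1 : Summable fun m : ℕ => (1 / 2 : ℝ) ^ (m + 1) :=
    (summable_nat_add_iff 1).2 (summable_geometric_of_lt_one (by norm_num) (by norm_num))
  have h2 : Summable fun m : ℕ => (1 / 2 : ℝ) ^ (m + 1) * (|x| + 1) := h1.mul_right _
  refine Summable.of_norm_bounded h2 fun m => ?_
  have h3 : |(⌊2 ^ (m + 1) * x⌋ : ℝ)| ≤ 2 ^ (m + 1) * |x| + 1 := by
    have ha := Int.floor_le ((2 : ℝ) ^ (m + 1) * x)
    have hb := Int.lt_floor_add_one ((2 : ℝ) ^ (m + 1) * x)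
    have hc := neg_abs_le ((2 : ℝ) ^ (m + 1) * x)
    have hd := le_abs_self ((2 : ℝ) ^ (m + 1) * x)
    have he : |(2 : ℝ) ^ (m + 1) * x| = 2 ^ (m + 1) * |x| := by
      rw [abs_mul, abs_of_pos (by positivity)]
    rw [he] at hc hd
    rw [abs_le]; constructor <;> linarith
  have h4 : (1 : ℝ) ≤ 2 ^ (m + 1) := one_le_pow₀ (by norm_num)
  rw [norm_mul, Real.norm_eq_abs, Real.norm_eq_abs, abs_of_pos (by positivity)]
  calc (1 / 4 : ℝ) ^ (m + 1) * |(⌊2 ^ (m + 1) * x⌋ : ℝ)|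
      ≤ (1 / 4 : ℝ) ^ (m + 1) * (2 ^ (m + 1) * |x| + 2 ^ (m + 1)) := by gcongr; linarith
    _ = (1 / 2 : ℝ) ^ (m + 1) * (|x| + 1) := by
      have : (1 / 2 : ℝ) ^ (m + 1) = (1 / 4) ^ (m + 1) * 2 ^ (m + 1) := by
        rw [← mul_pow]; norm_num
      rw [this]; ring

lemma dyadicJump_add_intCast (x : ℝ) (j : ℤ) : dyadicJump (x + j) = dyadicJump x + j := by
  unfold dyadicJump
  have h1 : HasSum (fun m : ℕ => (1 / 2 : ℝ) ^ (m + 1) * j) ((1 : ℝ) * j) := by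
    refine HasSum.mul_right _ ?_
    have := hasSum_geometric_two.mul_left (1 / 2 : ℝ)
    norm_num at this
    convert this using 2 with m
    rw [pow_succ']
  have h2 : ∀ m : ℕ, (1 / 4 : ℝ) ^ (m + 1) * ⌊2 ^ (m + 1) * (x + j)⌋ =
      (1 / 4 : ℝ) ^ (m + 1) * ⌊2 ^ (m + 1) * x⌋ + (1 / 2 : ℝ) ^ (m + 1) * j := by
    intro m
    have e : (2 : ℝ) ^ (m + 1) * (x + j) = 2 ^ (m + 1) * x + ((2 ^ (m + 1) * j : ℤ) : ℝ) := by
      push_cast; ring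
    have e' : (1 / 2 : ℝ) ^ (m + 1) = (1 / 4) ^ (m + 1) * 2 ^ (m + 1) := by
      rw [← mul_pow]; norm_num
    rw [e, Int.floor_add_intCast, e']
    push_cast; ring
  simp_rw [h2]
  rw [(summable_dyadicJump x).tsum_add h1.summable, h1.tsum_eq, one_mul]

lemma dyadicJump_zero : dyadicJump 0 = 0 := by simp [dyadicJump]

lemma dyadicJump_intCast (j : ℤ) : dyadicJump j = j := by
  have := dyadicJump_add_intCast 0 j
  rwa [zero_add, dyadicJump_zero, zero_add] at this

lemma strictMono_dyadicJump : StrictMono dyadicJump := by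
  intro x y hxy
  obtain ⟨m, hm⟩ := pow_unbounded_of_one_lt (1 / (y - x)) (one_lt_two (α := ℝ))
  have hpos : 0 < y - x := sub_pos.2 hxy
  rw [div_lt_iff₀ hpos] at hm
  refine Summable.tsum_lt_tsum (i := m) (fun i => ?_) ?_ (summable_dyadicJump x)
    (summable_dyadicJump y)
  · refine mul_le_mul_of_nonneg_left ?_ (by positivity)
    exact Int.cast_le.2 (Int.floor_le_floor (mul_le_mul_of_nonneg_left hxy.le (by positivity)))
  · refine mul_lt_mul_of_pos_left ?_ (by positivity)
    have h1 : (2 : ℝ) ^ (m + 1) * x + 1 ≤ 2 ^ (m + 1) * y := by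
      rw [pow_succ]; nlinarith
    have h2 := Int.floor_le_floor h1
    rw [Int.floor_add_one] at h2
    exact_mod_cast (by omega : ⌊(2 : ℝ) ^ (m + 1) * x⌋ < ⌊(2 : ℝ) ^ (m + 1) * y⌋)

lemma four_mul_dyadicJump (x : ℝ) : 4 * dyadicJump x = ⌊2 * x⌋ + dyadicJump (2 * x) := by
  unfold dyadicJump
  rw [(summable_dyadicJump x).tsum_eq_zero_add, mul_add, ← tsum_mul_left]
  congr 1
  · simp
  · congr 1; ext m
    rw [pow_succ _ (m + 1), pow_succ _ (m + 1), mul_assoc _ 2 x]; ring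

lemma four_pow_mul_dyadicJump (m : ℕ) (x : ℝ) :
    ∃ j : ℤ, 4 ^ m * dyadicJump x = dyadicJump (2 ^ m * x) + j := by
  induction m with
  | zero => exact ⟨0, by simp⟩
  | succ m ih =>
    obtain ⟨j, hj⟩ := ih
    refine ⟨⌊2 * (2 ^ m * x)⌋ + 4 * j, ?_⟩
    have h := four_mul_dyadicJump (2 ^ m * x)
    rw [pow_succ', mul_assoc, hj, pow_succ', mul_assoc]
    push_cast
    linarith

lemma dyadicJump_mem_Icc {y : ℝ} (h0 : 0 ≤ y) (h1 : y ≤ 1) : dyadicJump y ∈ Icc (0 : ℝ) 1 := by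
  have a := strictMono_dyadicJump.monotone h0
  have b := strictMono_dyadicJump.monotone h1
  have c := dyadicJump_intCast 1
  rw [dyadicJump_zero] at a
  norm_num at c
  rw [c] at b
  exact ⟨a, b⟩

/-- A continuous `1`-periodic function that vanishes on `[0, 1/4]` and equals `1` on
`[1/2, 3/4]`. -/
noncomputable def plateau (t : ℝ) : ℝ :=
  max 0 (min 1 (1 / 2 - Real.cos (2 * Real.pi * t - Real.pi / 4)))

lemma continuous_plateau : Continuous plateau := by unfold plateau; fun_prop

lemma plateau_add_intCast (t : ℝ) (j : ℤ) : plateau (t + j) = plateau t := by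
  unfold plateau
  have : 2 * Real.pi * (t + j) - Real.pi / 4 = 2 * Real.pi * t - Real.pi / 4 + j * (2 * Real.pi) := by
    ring
  rw [this, Real.cos_add_int_mul_two_pi]

lemma abs_plateau_le (t : ℝ) : |plateau t| ≤ 1 := by
  unfold plateau
  rw [abs_of_nonneg (le_max_left _ _)]
  exact max_le zero_le_one (min_le_left _ _)

lemma half_le_cos {α : ℝ} (h : |α| ≤ Real.pi / 4) : 1 / 2 ≤ Real.cos α := by
  have hpi := Real.pi_pos
  rw [← Real.cos_abs α, ← Real.cos_pi_div_three]
  exact Real.cos_le_cos_of_nonneg_of_le_pi (abs_nonneg _) (by linarith) (by linarith)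

lemma plateau_eq_zero {t : ℝ} (h0 : 0 ≤ t) (h1 : t ≤ 1 / 4) : plateau t = 0 := by
  have hpi := Real.pi_pos
  have := half_le_cos (α := 2 * Real.pi * t - Real.pi / 4)
    (by rw [abs_le]; constructor <;> nlinarith)
  exact max_eq_left ((min_le_right _ _).trans (by linarith))

lemma plateau_eq_one {t : ℝ} (h0 : 1 / 2 ≤ t) (h1 : t ≤ 3 / 4) : plateau t = 1 := by
  have hpi := Real.pi_pos
  have h := half_le_cos (α := 2 * Real.pi * t - Real.pi / 4 - Real.pi)
    (by rw [abs_le]; constructor <;> nlinarith)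
  rw [Real.cos_sub_pi] at h
  unfold plateau
  rw [min_eq_left (by linarith), max_eq_right zero_le_one]

lemma plateau_dyadicJump (y : ℝ) : plateau (dyadicJump y) = binaryDigit y := by
  rw [← Int.fract_add_floor y, dyadicJump_add_intCast, plateau_add_intCast,
    binaryDigit_add_intCast]
  have h0 := Int.fract_nonneg y
  have h1 := Int.fract_lt_one y
  set z := Int.fract y
  have h4 := four_mul_dyadicJump z
  rcases lt_or_ge z (1 / 2) with hz | hz
  · have hf : ⌊2 * z⌋ = 0 := Int.floor_eq_iff.2 ⟨by norm_num; linarith, by norm_num; linarith⟩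
    have hm := dyadicJump_mem_Icc (y := 2 * z) (by linarith) (by linarith)
    rw [hf, Int.cast_zero, zero_add] at h4
    rw [binaryDigit_of_lt_half h0 hz]
    exact plateau_eq_zero (by linarith [hm.1]) (by linarith [hm.2])
  · have hf : ⌊2 * z⌋ = 1 := Int.floor_eq_iff.2 ⟨by norm_num; linarith, by norm_num; linarith⟩
    have hm := dyadicJump_mem_Icc (y := 2 * z - 1) (by linarith) (by linarith)
    have hj := dyadicJump_add_intCast (2 * z - 1) 1
    rw [Int.cast_one, sub_add_cancel] at hj
    rw [hf, Int.cast_one, hj] at h4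
    rw [binaryDigit_of_half_le hz h1]
    exact plateau_eq_one (by linarith [hm.1]) (by linarith [hm.2])

/-- The left inverse of `dyadicJump`, a Cantor function: constant on the gaps. -/
noncomputable def cantorTime (t : ℝ) : ℝ := sSup {x | dyadicJump x ≤ t}

lemma bddAbove_dyadicJump_le (t : ℝ) : BddAbove {x | dyadicJump x ≤ t} := by
  refine ⟨⌈t⌉, fun x hx => ?_⟩
  rw [← strictMono_dyadicJump.le_iff_le, dyadicJump_intCast]
  exact le_trans hx (Int.le_ceil t)

lemma nonempty_dyadicJump_le (t : ℝ) : {x | dyadicJump x ≤ t}.Nonempty :=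
  ⟨⌊t⌋, by rw [mem_ofPred_eq, dyadicJump_intCast]; exact Int.floor_le t⟩

lemma monotone_cantorTime : Monotone cantorTime := fun s t hst =>
  csSup_le_csSup (bddAbove_dyadicJump_le t) (nonempty_dyadicJump_le s)
    fun _ hx => le_trans hx hst

lemma cantorTime_dyadicJump (x : ℝ) : cantorTime (dyadicJump x) = x := by
  unfold cantorTime
  simp_rw [strictMono_dyadicJump.le_iff_le]
  exact csSup_Iic

lemma continuous_cantorTime : Continuous cantorTime :=
  monotone_cantorTime.continuous_of_surjective fun x => ⟨_, cantorTime_dyadicJump x⟩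

lemma cantorTime_intCast (j : ℤ) : cantorTime j = j := by
  conv_lhs => rw [← dyadicJump_intCast j]
  exact cantorTime_dyadicJump j

/-- The angle of the moving point as a continuous function of time. -/
noncomputable def movingAngle (t : ℝ) : ℝ := ∑' m : ℕ, weight m * plateau (4 ^ m * t)

lemma continuous_movingAngle : Continuous movingAngle := by
  have := continuous_plateau
  refine continuous_tsum (fun m => by fun_prop) summable_abs_weight fun m t => ?_
  rw [norm_mul]
  exact mul_le_of_le_one_right (abs_nonneg _) (abs_plateau_le _)

/-- On the Cantor set of times the moving angle is the digit sum: multiplying by `4 ^ m` shifts the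
binary digits of `x` by `m` places up to an integer, and `plateau` reads off the first digit. -/
lemma movingAngle_dyadicJump (x : ℝ) : movingAngle (dyadicJump x) = digitSum weight x := by
  unfold movingAngle digitSum
  congr 1; ext m
  obtain ⟨j, hj⟩ := four_pow_mul_dyadicJump m x
  rw [hj, plateau_add_intCast, plateau_dyadicJump]

/-- The height above the angle `θ` of the growing region at time `t`, in a model where one unit
of time fills a layer of height one. -/
noncomputable def modelHeight (θ t : ℝ) : ℝ := occupationDensity θ (cantorTime t)

lemma modelHeight_mono (θ : ℝ) : Monotone (modelHeight θ) :=
  (occupationDensity_mono θ).comp monotone_cantorTime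

lemma modelHeight_intCast (θ : ℝ) (j : ℤ) : modelHeight θ j = j := by
  rw [modelHeight, cantorTime_intCast, occupationDensity_intCast]

/-- The height changes only at the angle of the moving point. -/
lemma modelHeight_eventually_eq {θ t : ℝ} (h : Real.cos (θ - movingAngle t) ≠ 1) :
    ∀ᶠ s in 𝓝 t, modelHeight θ s = modelHeight θ t := by
  have hlt : Real.cos (θ - movingAngle t) < 1 := lt_of_le_of_ne (Real.cos_le_one _) h
  obtain ⟨c, hc, hc1⟩ := exists_between hlt
  have hcont : Continuous fun s => Real.cos (θ - movingAngle s) := by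
    have := continuous_movingAngle
    fun_prop
  obtain ⟨η, hη, hball⟩ := Metric.eventually_nhds_iff.1
    (hcont.continuousAt.eventually_lt continuousAt_const hc)
  have key : ∀ a b, dist a t < η → dist b t < η → a ≤ b → modelHeight θ a = modelHeight θ b := by
    intro a b ha hb hab
    refine occupationDensity_eq_of_cos_le (monotone_cantorTime hab) (sub_pos.2 hc1)
      fun x hx => ?_
    -- A measure time strictly between those of `a` and `b` comes from a time between `a` and `b`.
    have h1 : a < dyadicJump x := by
      by_contra! hle
      have := monotone_cantorTime hle
      rw [cantorTime_dyadicJump] at this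
      exact absurd hx.1 (not_lt.2 this)
    have h2 : dyadicJump x < b := by
      by_contra! hle
      have := monotone_cantorTime hle
      rw [cantorTime_dyadicJump] at this
      exact absurd hx.2 (not_lt.2 this)
    have hd : dist (dyadicJump x) t < η := by
      rw [Real.dist_eq, abs_lt] at ha hb ⊢
      constructor <;> linarith [ha.1, hb.2]
    have := hball hd
    rw [movingAngle_dyadicJump] at this
    linarith
  filter_upwards [Metric.ball_mem_nhds t hη] with s hs
  rcases le_total s t with hst | hst
  · exact key s t hs (by simpa using hη) hst
  · exact (key t s (by simpa using hη) hs hst).symm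

lemma continuous_comp_snd {f : ℝ → ℝ → ℝ} (hf : Continuous fun q : ℝ × ℝ => f q.1 q.2)
    {g : ℝ → ℝ} (hg : Continuous g) : Continuous fun q : ℝ × ℝ => f q.1 (g q.2) :=
  hf.comp (continuous_fst.prodMk (hg.comp continuous_snd))

lemma continuous_modelHeight : Continuous fun q : ℝ × ℝ => modelHeight q.1 q.2 := by
  unfold modelHeight occupationDensity
  have h1 := continuous_cantorTime
  have h2 : Continuous fun q : ℝ × ℝ => densityWave q.1 (cantorTime q.2) :=
    continuous_comp_snd continuous_densityWave h1
  fun_prop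

/-- The slope of the model curve of time `t` at the angle `θ`. -/
noncomputable def modelSlope (θ t : ℝ) : ℝ := densityWaveDeriv θ (cantorTime t)

lemma hasDerivAt_modelHeight (θ t : ℝ) :
    HasDerivAt (fun θ => modelHeight θ t) (modelSlope θ t) θ :=
  (hasDerivAt_densityWave θ (cantorTime t)).const_add (cantorTime t)

lemma continuous_modelSlope : Continuous fun q : ℝ × ℝ => modelSlope q.1 q.2 := by
  exact continuous_comp_snd continuous_densityWaveDeriv continuous_cantorTime

lemma modelSlope_intCast (θ : ℝ) (j : ℤ) : modelSlope θ j = 0 := by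
  rw [modelSlope, cantorTime_intCast, densityWaveDeriv_intCast]

lemma modelHeight_add_two_pi (θ t : ℝ) :
    modelHeight (θ + 2 * Real.pi) t = modelHeight θ t := by
  simp [modelHeight, occupationDensity, densityWave_add_two_pi]

lemma contDiff_modelHeight (t : ℝ) : ContDiff ℝ ∞ fun θ => modelHeight θ t :=
  contDiff_const.add (contDiff_densityWave (cantorTime t))

/-! ### Grids of the half-line subordinate to a gauge -/

/-- A function that is locally bounded below by positive constants on the half-line dominates a
continuous step size, in the sense that the step stays below the function on the whole interval
that it covers. -/
lemma exists_continuous_step {m : ℝ → ℝ} (hm : ∀ s, 0 < s → ∃ η > 0, ∀ᶠ r in 𝓝 s, η ≤ m r) :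
    ∃ c : ℝ → ℝ, Continuous c ∧ (∀ s, 0 < s → 0 < c s) ∧ (∀ s, 0 < s → c s ≤ s / 2) ∧
      ∀ s, 0 < s → ∀ r, |s - r| ≤ c s → c s < m r := by
  -- Half the distance from `(s, 0)` to the region on or above the graph of `m`.
  set S : Set (ℝ × ℝ) := {q | q.1 ≤ 0 ∨ m q.1 ≤ q.2}
  have h0S : ((0 : ℝ), (0 : ℝ)) ∈ S := Or.inl le_rfl
  have hpos : ∀ s, 0 < s → 0 < Metric.infDist (s, (0 : ℝ)) S := by
    intro s hs
    refine (Metric.infDist_pos_iff_notMem_closure ⟨_, h0S⟩).1 ?_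
    rw [mem_closure_iff_frequently,
      not_frequently]
    obtain ⟨η, hη, hev⟩ := hm s hs
    have h1 : ∀ᶠ q : ℝ × ℝ in 𝓝 (s, 0), η ≤ m q.1 :=
      (continuous_fst.tendsto (s, (0 : ℝ))).eventually hev
    have h2 : ∀ᶠ q : ℝ × ℝ in 𝓝 (s, 0), 0 < q.1 :=
      continuous_fst.continuousAt.eventually_const_lt hs
    have h3 : ∀ᶠ q : ℝ × ℝ in 𝓝 (s, 0), q.2 < η :=
      continuous_snd.continuousAt.eventually_lt_const hη
    filter_upwards [h1, h2, h3] with q h1 h2 h3 hq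
    rcases hq with hq | hq <;> linarith
  have hle : ∀ s, 0 < s → Metric.infDist (s, (0 : ℝ)) S / 2 ≤ s / 2 := by
    intro s hs
    have h := Metric.infDist_le_dist_of_mem (x := (s, (0 : ℝ))) h0S
    rw [Prod.dist_eq, dist_self, Real.dist_eq, sub_zero, abs_of_pos hs, max_eq_left hs.le] at h
    linarith
  refine ⟨fun s => Metric.infDist (s, (0 : ℝ)) S / 2, ?_, fun s hs => half_pos (hpos s hs), hle,
    ?_⟩
  · exact ((Metric.continuous_infDist_pt S).comp (by fun_prop)).div_const 2
  · intro s hs r hr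
    have hp := hpos s hs
    have hl := hle s hs
    simp only at hr ⊢
    have hr0 : 0 < r := by linarith [le_abs_self (s - r)]
    obtain ⟨η, hη, hev⟩ := hm r hr0
    have hmr : 0 < m r := hη.trans_le hev.self_of_nhds
    have h := Metric.infDist_le_dist_of_mem (x := (s, (0 : ℝ))) (y := (r, m r)) (s := S)
      (Or.inr le_rfl)
    rw [Prod.dist_eq, Real.dist_eq, Real.dist_eq, zero_sub, abs_neg, abs_of_pos hmr,
      le_max_iff] at h
    rcases h with h | h <;> linarith

/-- The half-line is cut by a two-sided increasing sequence into intervals, each shorter than the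
gauge at any of its points. -/
lemma exists_int_grid {m : ℝ → ℝ} (hm : ∀ s, 0 < s → ∃ η > 0, ∀ᶠ r in 𝓝 s, η ≤ m r) :
    ∃ T : ℤ → ℝ, (∀ j, 0 < T j) ∧ StrictMono T ∧
      (∀ j, ∀ r ∈ Icc (T j) (T (j + 1)), T (j + 1) - T j < m r) ∧
      (∀ r, 0 < r → ∃ j, T j ≤ r) ∧ ∀ r, ∃ j, r < T j := by
  obtain ⟨c, hcont, hpos, hhalf, hlt⟩ := exists_continuous_step hm
  -- Two sequences of steps issuing from `1`; a limit in the half-line would be a zero of `c`.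
  let up : ℕ → ℝ := fun n => (fun s => s + c s)^[n] 1
  let down : ℕ → ℝ := fun n => (fun s => s - c s)^[n] 1
  have up_succ : ∀ n, up (n + 1) = up n + c (up n) := fun n => Function.iterate_succ_apply' _ n 1
  have down_succ : ∀ n, down (n + 1) = down n - c (down n) :=
    fun n => Function.iterate_succ_apply' _ n 1
  have up_pos : ∀ n, 0 < up n := by
    intro n
    induction n with
    | zero => exact one_pos
    | succ n ih => rw [up_succ]; exact add_pos ih (hpos _ ih)
  have down_pos : ∀ n, 0 < down n := by
    intro n
    induction n with
    | zero => exact one_pos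
    | succ n ih => rw [down_succ]; linarith [hhalf _ ih]
  have up_mono : Monotone up := monotone_nat_of_le_succ fun n => by
    rw [up_succ]; linarith [hpos _ (up_pos n)]
  have down_anti : Antitone down := antitone_nat_of_succ_le fun n => by
    rw [down_succ]; linarith [hpos _ (down_pos n)]
  let T : ℤ → ℝ := fun j => Int.casesOn j up fun n => down (n + 1)
  have T_pos : ∀ j, 0 < T j := by
    rintro (n | n)
    · exact up_pos n
    · exact down_pos (n + 1)
  have step : ∀ j : ℤ, (∃ s, 0 < s ∧ T j = s ∧ T (j + 1) = s + c s) ∨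
      ∃ s, 0 < s ∧ T (j + 1) = s ∧ T j = s - c s := by
    rintro (n | n)
    · exact Or.inl ⟨up n, up_pos n, rfl, up_succ n⟩
    · refine Or.inr ⟨down n, down_pos n, ?_, down_succ n⟩
      cases n with
      | zero => rfl
      | succ n => rfl
  have T_lt : ∀ j, T j < T (j + 1) := by
    intro j
    rcases step j with ⟨s, hs, h1, h2⟩ | ⟨s, hs, h1, h2⟩ <;> rw [h1, h2] <;> linarith [hpos s hs]
  refine ⟨T, T_pos, strictMono_int_of_lt_succ T_lt, ?_, ?_, ?_⟩
  · intro j r hr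
    rcases step j with ⟨s, hs, h1, h2⟩ | ⟨s, hs, h1, h2⟩
    · rw [h1, h2] at hr ⊢
      rw [add_sub_cancel_left]
      exact hlt s hs r (by rw [abs_le]; constructor <;> linarith [hr.1, hr.2])
    · rw [h1, h2] at hr ⊢
      rw [sub_sub_cancel]
      exact hlt s hs r (by rw [abs_le]; constructor <;> linarith [hr.1, hr.2])
  · intro r hr
    rcases tendsto_atTop_of_antitone down_anti with h | ⟨l, hl⟩
    · obtain ⟨n, hn⟩ := (h.eventually_lt_atBot 0).exists
      exact absurd hn (not_lt.2 (down_pos n).le)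
    · have hl0 : 0 ≤ l := ge_of_tendsto' hl fun n => (down_pos n).le
      have h1 : Tendsto (fun n => down n - c (down n)) atTop (𝓝 (l - c l)) :=
        hl.sub ((hcont.tendsto l).comp hl)
      have h2 : Tendsto (fun n => down (n + 1)) atTop (𝓝 l) := hl.comp (tendsto_add_atTop_nat 1)
      simp_rw [down_succ] at h2
      have h3 := tendsto_nhds_unique h1 h2
      have hl1 : l = 0 := by
        by_contra hne
        have := hpos l (lt_of_le_of_ne hl0 (Ne.symm hne))
        linarith
      rw [hl1] at hl
      obtain ⟨n, hn⟩ := ((hl.comp (tendsto_add_atTop_nat 1)).eventually_lt_const hr).exists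
      exact ⟨Int.negSucc n, hn.le⟩
  · intro r
    rcases tendsto_atTop_of_monotone up_mono with h | ⟨l, hl⟩
    · obtain ⟨n, hn⟩ := (h.eventually_gt_atTop r).exists
      exact ⟨n, hn⟩
    · have hl0 : 1 ≤ l := ge_of_tendsto' hl fun n => up_mono (Nat.zero_le n)
      have h1 : Tendsto (fun n => up n + c (up n)) atTop (𝓝 (l + c l)) :=
        hl.add ((hcont.tendsto l).comp hl)
      have h2 : Tendsto (fun n => up (n + 1)) atTop (𝓝 l) := hl.comp (tendsto_add_atTop_nat 1)
      simp_rw [up_succ] at h2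
      have h3 := tendsto_nhds_unique h1 h2
      have := hpos l (by linarith)
      linarith

/-- There is an increasing bijection from the line to the half-line that is affine between
consecutive integers, with slopes smaller than a given gauge. -/
lemma exists_piecewise_affine_orderIso {m : ℝ → ℝ}
    (hm : ∀ s, 0 < s → ∃ η > 0, ∀ᶠ r in 𝓝 s, η ≤ m r) :
    ∃ (g : ℝ ≃o Ioi (0 : ℝ)) (h : ℤ → ℝ), ∀ j : ℤ, 0 < h j ∧
      ∀ y ∈ Icc (j : ℝ) (j + 1), (g y : ℝ) = g j + h j * (y - j) ∧ h j < m (g y) := by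
  obtain ⟨T, hpos, hmono, hgap, hlow, hhigh⟩ := exists_int_grid hm
  set G : ℝ → ℝ := fun y => T ⌊y⌋ + (T (⌊y⌋ + 1) - T ⌊y⌋) * (y - ⌊y⌋) with hG
  have hstep : ∀ j, 0 < T (j + 1) - T j := fun j => sub_pos.2 (hmono (lt_add_one j))
  have G_low : ∀ y, T ⌊y⌋ ≤ G y := fun y =>
    le_add_of_nonneg_right (mul_nonneg (hstep _).le (Int.fract_nonneg y))
  have G_high : ∀ y, G y < T (⌊y⌋ + 1) := by
    intro y
    have := mul_lt_mul_of_pos_left (Int.fract_lt_one y) (hstep ⌊y⌋)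
    simp only [hG]
    rw [Int.fract] at this
    linarith
  have G_int : ∀ j : ℤ, G j = T j := by intro j; simp [hG]
  have G_affine : ∀ j : ℤ, ∀ y ∈ Icc (j : ℝ) (j + 1), G y = G j + (T (j + 1) - T j) * (y - j) := by
    intro j y hy
    rcases eq_or_lt_of_le hy.2 with h | h
    · have : y = ((j + 1 : ℤ) : ℝ) := by rw [h]; push_cast; rfl
      rw [this, G_int, G_int]; push_cast; ring
    · have : ⌊y⌋ = j := Int.floor_eq_iff.2 ⟨hy.1, h⟩
      rw [G_int]
      simp only [hG, this]
  have G_mono : StrictMono G := by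
    intro x y hxy
    rcases eq_or_lt_of_le (Int.floor_le_floor hxy.le) with h | h
    · simp only [hG, h]
      have := mul_lt_mul_of_pos_left (sub_lt_sub_right hxy (⌊y⌋ : ℝ)) (hstep ⌊y⌋)
      linarith
    · exact ((G_high x).trans_le (hmono.monotone (Int.add_one_le_of_lt h))).trans_le (G_low y)
  have G_surj : ∀ r, 0 < r → ∃ y, G y = r := by
    intro r hr
    obtain ⟨a, ha⟩ := hlow r hr
    obtain ⟨b, hb⟩ := hhigh r
    obtain ⟨j, hj, hmax⟩ := Int.exists_greatest_of_bdd (P := fun j => T j ≤ r)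
      ⟨b, fun z hz => hmono.le_iff_le.1 (hz.trans hb.le)⟩ ⟨a, ha⟩
    have hj' : r < T (j + 1) := by
      by_contra! hle
      have := hmax _ hle
      omega
    have hs := hstep j
    have hfrac : 0 ≤ (r - T j) / (T (j + 1) - T j) := div_nonneg (sub_nonneg.2 hj) hs.le
    have hfrac' : (r - T j) / (T (j + 1) - T j) ≤ 1 := (div_le_one hs).2 (by linarith)
    refine ⟨j + (r - T j) / (T (j + 1) - T j), ?_⟩
    rw [G_affine j _ ⟨by linarith, by linarith⟩, G_int]
    field_simp
    ring
  have G_pos : ∀ y, 0 < G y := fun y => (hpos _).trans_le (G_low y)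
  let g : ℝ ≃o Ioi (0 : ℝ) := StrictMono.orderIsoOfSurjective (fun y => ⟨G y, G_pos y⟩)
    (fun x y hxy => G_mono hxy) fun r => by
      obtain ⟨y, hy⟩ := G_surj r r.2
      exact ⟨y, Subtype.ext hy⟩
  have hg : ∀ y, (g y : ℝ) = G y := fun y => rfl
  refine ⟨g, fun j => T (j + 1) - T j, fun j => ⟨hstep j, fun y hy => ?_⟩⟩
  rw [hg, hg]
  refine ⟨G_affine j y hy, hgap j _ ?_⟩
  have h2 : ((j + 1 : ℤ) : ℝ) = j + 1 := by push_cast; rfl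
  rw [← G_int, ← G_int, h2]
  exact ⟨G_mono.monotone hy.1, G_mono.monotone hy.2⟩

/-! ### Radial growth -/

/-- A region that grows radially: `u θ t` is its radius at time `t` in the direction `θ`, with
derivative `u' θ t` in `θ`, and it grows at time `t` only in the direction `φ t`. -/
structure IsRadialGrowth (u u' : ℝ → ℝ → ℝ) (φ : ℝ → ℝ) : Prop where
  pos : ∀ θ t, 0 < t → 0 < u θ t
  le_two_mul : ∀ θ t, 0 < t → u θ t ≤ 2 * t
  le_two_mul_self : ∀ θ t, 0 < t → t ≤ 2 * u θ t
  monotoneOn : ∀ θ, MonotoneOn (u θ) (Ioi 0)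
  periodic : ∀ θ t, u (θ + 2 * Real.pi) t = u θ t
  contDiff : ∀ t, 0 < t → ContDiff ℝ ∞ fun θ => u θ t
  hasDerivAt : ∀ θ t, 0 < t → HasDerivAt (fun θ => u θ t) (u' θ t) θ
  continuousOn : ContinuousOn (fun q : ℝ × ℝ => u q.1 q.2) (univ ×ˢ Ioi 0)
  continuousOn_deriv : ContinuousOn (fun q : ℝ × ℝ => u' q.1 q.2) (univ ×ˢ Ioi 0)
  continuousOn_angle : ContinuousOn φ (Ioi 0)
  eventually_eq : ∀ θ t, 0 < t → Real.cos (θ - φ t) ≠ 1 → ∀ᶠ s in 𝓝 t, u θ s = u θ t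

lemma continuousOn_comp_snd {F : ℝ → ℝ → ℝ} (hF : Continuous fun q : ℝ × ℝ => F q.1 q.2)
    {Y : ℝ → ℝ} {s : Set ℝ} (hY : ContinuousOn Y s) :
    ContinuousOn (fun q : ℝ × ℝ => F q.1 (Y q.2)) (univ ×ˢ s) :=
  hF.comp_continuousOn
    (continuousOn_fst.prodMk (hY.comp continuousOn_snd fun _ hq => hq.2))

/-- A function that vanishes on the integer levels remains continuous when it is rescaled on
each layer between consecutive integers. -/
lemma continuous_floor_mul (h : ℤ → ℝ) {F : ℝ → ℝ → ℝ}
    (hF : Continuous fun q : ℝ × ℝ => F q.1 q.2) (h0 : ∀ x (j : ℤ), F x j = 0) :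
    Continuous fun q : ℝ × ℝ => h ⌊q.2⌋ * F q.1 q.2 := by
  have hlf : LocallyFinite fun j : ℤ => Icc (j : ℝ) (j + 1) :=
    locallyFinite_Icc_of_tendsto tendsto_intCast_atTop_atTop
      (tendsto_atBot_add_const_right _ _ (tendsto_intCast_atBot_iff.2 tendsto_id))
  refine (hlf.preimage_continuous (continuous_snd (X := ℝ))).continuous ?_
    (fun j => isClosed_Icc.preimage continuous_snd) fun j => ?_
  · refine eq_univ_of_forall fun q => mem_iUnion.2 ⟨⌊q.2⌋, ?_⟩
    exact ⟨Int.floor_le q.2, (Int.lt_floor_add_one q.2).le⟩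
  · refine (hF.const_mul (h j)).continuousOn.congr fun q hq => ?_
    rcases eq_or_lt_of_le hq.2 with he | hl
    · have : q.2 = ((j + 1 : ℤ) : ℝ) := by rw [he]; push_cast; rfl
      simp only [this, h0, mul_zero]
    · have : ⌊q.2⌋ = j := Int.floor_eq_iff.2 ⟨hq.1, hl⟩
      simp only [this]

lemma modelHeight_mem_Icc {y : ℝ} {j : ℤ} (hy : y ∈ Icc (j : ℝ) (j + 1)) (θ : ℝ) :
    modelHeight θ y ∈ Icc (j : ℝ) (j + 1) := by
  have h1 := modelHeight_mono θ hy.1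
  have h2 := modelHeight_mono θ hy.2
  have h3 := modelHeight_intCast θ (j + 1)
  push_cast at h3
  rw [h3] at h2
  rw [modelHeight_intCast] at h1
  exact ⟨h1, h2⟩

/-- The model rescaled layer by layer gives a radial growth whose curve of time `t` is the circle
of radius `t` up to an arbitrarily small multiple of a model curve. -/
lemma exists_isRadialGrowth {m : ℝ → ℝ} (hm : ∀ s, 0 < s → ∃ η > 0, ∀ᶠ r in 𝓝 s, η ≤ m r) :
    ∃ (u u' : ℝ → ℝ → ℝ) (φ : ℝ → ℝ), IsRadialGrowth u u' φ ∧
      ∀ t, 0 < t → ∃ h y : ℝ, 0 ≤ h ∧ h < m t ∧ ∀ θ, u θ t - t = h * (modelHeight θ y - y) := by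
  -- Layers thinner than their distance from the origin keep `u θ t` comparable with `t`.
  have hm' : ∀ s, 0 < s → ∃ η > 0, ∀ᶠ r in 𝓝 s, η ≤ min (m r) r := by
    intro s hs
    obtain ⟨η, hη, hev⟩ := hm s hs
    refine ⟨min η (s / 2), lt_min hη (half_pos hs), ?_⟩
    filter_upwards [hev, lt_mem_nhds (half_lt_self hs)] with r h1 h2
    exact min_le_min h1 h2.le
  obtain ⟨g, h, hgh⟩ := exists_piecewise_affine_orderIso hm'
  set Y : ℝ → ℝ := fun t => if ht : 0 < t then g.symm ⟨t, ht⟩ else 0 with hY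
  have gY : ∀ t, 0 < t → (g (Y t) : ℝ) = t := by
    intro t ht; simp only [hY, dif_pos ht, OrderIso.apply_symm_apply]
  have Y_mono : MonotoneOn Y (Ioi 0) := by
    intro s hs t ht hst
    rw [← g.le_iff_le, ← Subtype.coe_le_coe, gY s hs, gY t ht]
    exact hst
  have Y_cont : ContinuousOn Y (Ioi 0) := by
    rw [continuousOn_iff_continuous_domRestrict]
    have : (Ioi (0 : ℝ)).domRestrict Y = g.symm := by
      ext t; simp only [domRestrict_apply, hY, dif_pos (show 0 < (t : ℝ) from t.2)]
    rw [this]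
    exact g.symm.continuous
  have g_cont : Continuous fun y => (g y : ℝ) := continuous_subtype_val.comp g.continuous
  have cell : ∀ t : ℝ, Y t ∈ Icc (⌊Y t⌋ : ℝ) (⌊Y t⌋ + 1) := fun t =>
    ⟨Int.floor_le _, (Int.lt_floor_add_one _).le⟩
  set u : ℝ → ℝ → ℝ := fun θ t => g (modelHeight θ (Y t)) with hu
  have u_eq : ∀ θ t, u θ t = g ⌊Y t⌋ + h ⌊Y t⌋ * (modelHeight θ (Y t) - ⌊Y t⌋) := fun θ t =>
    ((hgh _).2 _ (modelHeight_mem_Icc (cell t) θ)).1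
  have t_eq : ∀ t, 0 < t → t = g ⌊Y t⌋ + h ⌊Y t⌋ * (Y t - ⌊Y t⌋) := fun t ht => by
    conv_lhs => rw [← gY t ht]
    exact ((hgh _).2 _ (cell t)).1
  have h_lt : ∀ t, 0 < t → h ⌊Y t⌋ < min (m t) t := fun t ht => by
    have := ((hgh ⌊Y t⌋).2 _ (cell t)).2
    rwa [gY t ht] at this
  refine ⟨u, fun θ t => h ⌊Y t⌋ * modelSlope θ (Y t), fun t => movingAngle (Y t),
    ⟨fun θ t _ => (g _).2, ?_, ?_, ?_, ?_, ?_, ?_, ?_, ?_, ?_, ?_⟩, ?_⟩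
  · intro θ t ht
    have h1 := u_eq θ t
    have h2 := t_eq t ht
    have h3 := (h_lt t ht).trans_le (min_le_right _ _)
    have h4 := modelHeight_mem_Icc (cell t) θ
    have h5 := (hgh ⌊Y t⌋).1
    have h6 : h ⌊Y t⌋ * (modelHeight θ (Y t) - ⌊Y t⌋) ≤ h ⌊Y t⌋ * 1 :=
      mul_le_mul_of_nonneg_left (by linarith [h4.2]) h5.le
    have h7 : 0 ≤ h ⌊Y t⌋ * (Y t - ⌊Y t⌋) := mul_nonneg h5.le (by linarith [(cell t).1])
    linarith
  · intro θ t ht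
    have h1 := u_eq θ t
    have h2 := t_eq t ht
    have h4 := modelHeight_mem_Icc (cell t) θ
    have h5 := (hgh ⌊Y t⌋).1
    have h3 : h ⌊Y t⌋ < g ⌊Y t⌋ := ((hgh ⌊Y t⌋).2 (⌊Y t⌋ : ℝ) ⟨le_rfl, by linarith⟩).2.trans_le
      (min_le_right _ _)
    have h6 : 0 ≤ h ⌊Y t⌋ * (modelHeight θ (Y t) - ⌊Y t⌋) :=
      mul_nonneg h5.le (by linarith [h4.1])
    have h7 : h ⌊Y t⌋ * (Y t - ⌊Y t⌋) ≤ h ⌊Y t⌋ * 1 :=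
      mul_le_mul_of_nonneg_left (by linarith [(cell t).2]) h5.le
    linarith
  · intro θ s hs t ht hst
    exact g.monotone (modelHeight_mono θ (Y_mono hs ht hst))
  · intro θ t
    simp only [hu, modelHeight_add_two_pi]
  · intro t _
    simp only [u_eq]
    exact contDiff_const.add (contDiff_const.mul ((contDiff_modelHeight (Y t)).sub contDiff_const))
  · intro θ t _
    simp only [u_eq]
    exact (((hasDerivAt_modelHeight θ (Y t)).sub_const _).const_mul _).const_add _
  · exact g_cont.comp_continuousOn (continuousOn_comp_snd continuous_modelHeight Y_cont)
  · exact continuousOn_comp_snd (F := fun θ y => h ⌊y⌋ * modelSlope θ y)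
      (continuous_floor_mul h continuous_modelSlope modelSlope_intCast) Y_cont
  · exact continuous_movingAngle.comp_continuousOn Y_cont
  · intro θ t ht hcos
    have := (Y_cont.continuousAt (Ioi_mem_nhds ht)).eventually (modelHeight_eventually_eq hcos)
    filter_upwards [this] with s hs
    simp only [hu, hs]
  · intro t ht
    refine ⟨h ⌊Y t⌋, Y t, (hgh _).1.le, (h_lt t ht).trans_le (min_le_left _ _), fun θ => ?_⟩
    have h1 := u_eq θ t
    have h2 := t_eq t ht
    linear_combination h1 - h2

/-! ### Polar coordinates in the plane -/

/-- The unit vector with polar angle `θ`; its derivative is the unit vector with polar angle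
`θ + π / 2`. -/
noncomputable def unitVec (θ : ℝ) : Plane := !₂[Real.cos θ, Real.sin θ]

lemma unitVec_eq (θ : ℝ) :
    unitVec θ = Real.cos θ • (!₂[1, 0] : Plane) + Real.sin θ • (!₂[0, 1] : Plane) := by
  ext i; fin_cases i <;> simp [unitVec]

lemma norm_unitVec (θ : ℝ) : ‖unitVec θ‖ = 1 := by
  simp [unitVec, EuclideanSpace.norm_eq]

lemma hasDerivAt_unitVec (θ : ℝ) : HasDerivAt unitVec (unitVec (θ + Real.pi / 2)) θ := by
  have h := ((Real.hasDerivAt_cos θ).smul_const (!₂[1, 0] : Plane)).add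
    ((Real.hasDerivAt_sin θ).smul_const (!₂[0, 1] : Plane))
  have e : unitVec = (fun y => Real.cos y • (!₂[1, 0] : Plane)) +
      fun y => Real.sin y • (!₂[0, 1] : Plane) := funext unitVec_eq
  rw [e]
  refine h.congr_deriv ?_
  simp [Real.cos_add_pi_div_two, Real.sin_add_pi_div_two]

lemma contDiff_unitVec : ContDiff ℝ ∞ unitVec := by
  rw [show unitVec = _ from funext unitVec_eq]
  exact (Real.contDiff_cos.smul contDiff_const).add (Real.contDiff_sin.smul contDiff_const)

lemma continuous_unitVec : Continuous unitVec := contDiff_unitVec.continuous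

lemma norm_smul_unitVec {r : ℝ} (hr : 0 ≤ r) (θ : ℝ) : ‖r • unitVec θ‖ = r := by
  rw [norm_smul, norm_unitVec, mul_one, Real.norm_of_nonneg hr]

lemma smul_unitVec_add_ne_zero (a : ℝ) {b : ℝ} (hb : b ≠ 0) (θ : ℝ) :
    a • unitVec θ + b • unitVec (θ + Real.pi / 2) ≠ 0 := by
  intro h
  have h0 := congrArg (fun v : Plane => v 0) h
  have h1 := congrArg (fun v : Plane => v 1) h
  simp [unitVec, Real.cos_add_pi_div_two, Real.sin_add_pi_div_two] at h0 h1
  apply hb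
  have := Real.sin_sq_add_cos_sq θ
  linear_combination (-Real.sin θ) * h0 + Real.cos θ * h1 - b * this

/-- The polar angle in `(-π, π]` of a point of the plane, zero at the origin. -/
noncomputable def polarAngle (p : Plane) : ℝ := Complex.arg ⟨p 0, p 1⟩

lemma norm_smul_unitVec_polarAngle (p : Plane) : ‖p‖ • unitVec (polarAngle p) = p := by
  have hn : ‖p‖ = ‖(⟨p 0, p 1⟩ : ℂ)‖ := by
    rw [EuclideanSpace.norm_eq, Complex.norm_eq_sqrt_sq_add_sq]; simp
  have h := Complex.norm_mul_cos_add_sin_mul_I (⟨p 0, p 1⟩ : ℂ)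
  rw [← hn] at h
  ext i
  fin_cases i
  · have := congrArg Complex.re h
    simpa [unitVec, polarAngle, ← Complex.ofReal_cos, ← Complex.ofReal_sin] using this
  · have := congrArg Complex.im h
    simpa [unitVec, polarAngle, ← Complex.ofReal_cos, ← Complex.ofReal_sin] using this

lemma coe_polarAngle_smul_unitVec {r : ℝ} (hr : 0 < r) (θ : ℝ) :
    (polarAngle (r • unitVec θ) : Real.Angle) = θ := by
  have h := Complex.arg_mul_cos_add_sin_mul_I_coe_angle hr θ
  rw [← h, polarAngle]
  congr 2
  apply Complex.ext <;> simp [unitVec, -Complex.ofReal_cos, -Complex.ofReal_sin]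

lemma continuousAt_coe_polarAngle {p : Plane} (hp : p ≠ 0) :
    ContinuousAt (fun q => (polarAngle q : Real.Angle)) p := by
  have hz : (⟨p 0, p 1⟩ : ℂ) ≠ 0 := by
    intro h
    apply hp
    ext i
    fin_cases i
    · exact congrArg Complex.re h
    · exact congrArg Complex.im h
  have hc : Continuous fun q : Plane => (⟨q 0, q 1⟩ : ℂ) := by
    have : (fun q : Plane => (⟨q 0, q 1⟩ : ℂ)) =
        fun q : Plane => ((q 0 : ℝ) : ℂ) + ((q 1 : ℝ) : ℂ) * Complex.I := by
      ext q; exact Complex.mk_eq_add_mul_I _ _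
    rw [this]; fun_prop
  exact ContinuousAt.comp (f := fun q : Plane => (⟨q 0, q 1⟩ : ℂ))
    (Complex.continuousAt_arg_coe_angle hz) hc.continuousAt

lemma continuous_of_continuous_comp_coe {X : Type*} [TopologicalSpace X] {f : Real.Angle → X}
    (hf : Continuous fun x : ℝ => f x) : Continuous f :=
  continuous_coinduced_dom.2 hf

lemma compactSpace_angle : CompactSpace Real.Angle := by
  have : Fact (0 < 2 * Real.pi) := ⟨Real.two_pi_pos⟩
  exact inferInstanceAs (CompactSpace (AddCircle (2 * Real.pi)))

lemma apply_eq_of_coe_eq {X : Type*} {f : ℝ → X} (hf : ∀ θ, f (θ + 2 * Real.pi) = f θ) {a b : ℝ}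
    (h : (a : Real.Angle) = b) : f a = f b := by
  obtain ⟨k, hk⟩ := Real.Angle.angle_eq_iff_two_pi_dvd_sub.1 h
  have hp : Function.Periodic f (2 * Real.pi) := hf
  have := hp.int_mul k b
  rw [← this]
  congr 1; linarith

lemma coe_eq_of_cos_sub_eq_one {a b : ℝ} (h : Real.cos (a - b) = 1) : (a : Real.Angle) = b := by
  obtain ⟨k, hk⟩ := (Real.cos_eq_one_iff _).1 h
  exact Real.Angle.angle_eq_iff_two_pi_dvd_sub.2 ⟨k, by rw [← hk]; ring⟩

lemma unitVec_add_two_pi (θ : ℝ) : unitVec (θ + 2 * Real.pi) = unitVec θ := by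
  simp [unitVec]

lemma coe_eq_of_unitVec_eq {a b : ℝ} (h : unitVec a = unitVec b) : (a : Real.Angle) = b := by
  have h0 := congrArg (fun v : Plane => v 0) h
  have h1 := congrArg (fun v : Plane => v 1) h
  simp only [unitVec] at h0 h1
  exact Real.Angle.cos_sin_inj (by simpa using h0) (by simpa using h1)

/-! ### The curves bounding a radial growth -/

namespace IsRadialGrowth

variable {u u' : ℝ → ℝ → ℝ} {φ : ℝ → ℝ}

/-- The curve bounding the region of time `t`, parametrized by the polar angle. -/
noncomputable def boundaryCurve (u : ℝ → ℝ → ℝ) (t : ℝ) (θ : Real.Angle) : Plane :=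
  u θ.toReal t • unitVec θ.toReal

/-- The moving point on the boundary of the growing region. -/
noncomputable def movingPoint (u : ℝ → ℝ → ℝ) (φ : ℝ → ℝ) (t : ℝ) : Plane :=
  if 0 < t then u (φ t) t • unitVec (φ t) else 0

/-- The velocity at the angle `θ` of the curve of time `t`. -/
noncomputable def velocity (u u' : ℝ → ℝ → ℝ) (θ t : ℝ) : Plane :=
  u' θ t • unitVec θ + u θ t • unitVec (θ + Real.pi / 2)

lemma periodicLift_boundaryCurve (hG : IsRadialGrowth u u' φ) (t : ℝ) :
    periodicLift (boundaryCurve u t) = fun x => u x t • unitVec x := by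
  ext1 x
  refine apply_eq_of_coe_eq (f := fun x => u x t • unitVec x) (fun θ => ?_)
    (Real.Angle.coe_toReal (x : Real.Angle))
  simp only [hG.periodic, unitVec_add_two_pi]

lemma hasDerivAt_boundaryCurve (hG : IsRadialGrowth u u' φ) {t : ℝ} (ht : 0 < t) (x : ℝ) :
    HasDerivAt (periodicLift (boundaryCurve u t)) (velocity u u' x t) x := by
  rw [hG.periodicLift_boundaryCurve]
  refine ((hG.hasDerivAt x t ht).smul (hasDerivAt_unitVec x)).congr_deriv ?_
  rw [velocity, add_comm]

lemma continuous_boundaryCurve (hG : IsRadialGrowth u u' φ) {t : ℝ} (ht : 0 < t) :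
    Continuous (boundaryCurve u t) := by
  refine continuous_of_continuous_comp_coe ?_
  have h := hG.periodicLift_boundaryCurve t
  unfold periodicLift at h
  rw [h]
  exact (hG.contDiff t ht).continuous.smul continuous_unitVec

lemma isSmoothCircleEmbedding (hG : IsRadialGrowth u u' φ) {t : ℝ} (ht : 0 < t) :
    IsSmoothCircleEmbedding (boundaryCurve u t) where
  contDiff := by
    rw [hG.periodicLift_boundaryCurve]
    exact (hG.contDiff t ht).smul contDiff_unitVec
  deriv_ne_zero x := by
    rw [(hG.hasDerivAt_boundaryCurve ht x).deriv]
    exact smul_unitVec_add_ne_zero _ (hG.pos x t ht).ne' x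
  isEmbedding := by
    have := compactSpace_angle
    refine ((hG.continuous_boundaryCurve ht).isClosedEmbedding fun θ ψ h => ?_).isEmbedding
    have hn := congrArg norm h
    unfold boundaryCurve at h hn
    rw [norm_smul_unitVec (hG.pos _ _ ht).le, norm_smul_unitVec (hG.pos _ _ ht).le] at hn
    rw [hn] at h
    have := coe_eq_of_unitVec_eq (smul_right_injective Plane (hG.pos ψ.toReal t ht).ne' h)
    rwa [Real.Angle.coe_toReal, Real.Angle.coe_toReal] at this

/-- Every point of the punctured plane lies on a curve at a time at which the moving point passes
through it. -/
lemma exists_time (hG : IsRadialGrowth u u' φ) {θ r t : ℝ} (hr : 0 < r) (ht : 0 < t)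
    (hrt : r ≤ u θ t) : ∃ s, 0 < s ∧ s ≤ t ∧ u θ s = r ∧ (φ s : Real.Angle) = θ := by
  have hcont : ContinuousOn (u θ) (Ioi 0) :=
    hG.continuousOn.comp (by fun_prop : ContinuousOn (fun s : ℝ => (θ, s)) (Ioi 0))
      fun s hs => ⟨mem_univ _, hs⟩
  -- The first time at which the height in the direction `θ` reaches `r`.
  set A : Set ℝ := Icc (r / 2) t ∩ u θ ⁻¹' Ici r
  have hmem : ∀ s, 0 < s → s ≤ t → r ≤ u θ s → s ∈ A := fun s h0 h1 h2 =>
    ⟨⟨by linarith [hG.le_two_mul θ s h0], h1⟩, h2⟩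
  have hAc : IsCompact A := by
    refine isCompact_Icc.of_isClosed_subset ?_ inter_subset_left
    exact (hcont.mono fun s hs => (half_pos hr).trans_le hs.1).preimage_isClosed_of_isClosed
      isClosed_Icc isClosed_Ici
  obtain ⟨s, ⟨⟨hs1, hs2⟩, hs3⟩, hmin⟩ := hAc.exists_isLeast ⟨t, hmem t ht le_rfl hrt⟩
  have hs0 : 0 < s := (half_pos hr).trans_le hs1
  have hcs : ContinuousAt (u θ) s := hcont.continuousAt (Ioi_mem_nhds hs0)
  have hearly : ¬ ∀ᶠ q in 𝓝 s, r ≤ u θ q := by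
    intro hev
    have h1 : ∀ᶠ q in 𝓝[<] s, r ≤ u θ q ∧ 0 < q ∧ q < s :=
      (hev.filter_mono nhdsWithin_le_nhds).and (Ioo_mem_nhdsLT hs0)
    obtain ⟨q, hq, hq0, hqs⟩ := h1.exists
    exact absurd (hmin (hmem q hq0 (hqs.le.trans hs2) hq)) (not_le.2 hqs)
  refine ⟨s, hs0, hs2, le_antisymm ?_ hs3, ?_⟩
  · by_contra! hlt
    exact hearly ((hcs.eventually (lt_mem_nhds hlt)).mono fun q hq => le_of_lt hq)
  · by_contra hne
    have hcos : Real.cos (θ - φ s) ≠ 1 := fun h => hne (coe_eq_of_cos_sub_eq_one h).symm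
    exact hearly ((hG.eventually_eq θ s hs0 hcos).mono fun q hq => by rw [hq]; exact hs3)

lemma radius_eq (hG : IsRadialGrowth u u' φ) {a b : ℝ} (h : (a : Real.Angle) = b) (t : ℝ) :
    u a t = u b t :=
  apply_eq_of_coe_eq (f := fun θ => u θ t) (fun θ => hG.periodic θ t) h

/-- The moving point fills the whole star-shaped region below the curve of time `t`. -/
lemma footprint_movingPoint (hG : IsRadialGrowth u u' φ) {t : ℝ} (ht : 0 < t) :
    footprint (movingPoint u φ) t = {p | ‖p‖ ≤ u (polarAngle p) t} := by
  ext p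
  constructor
  · rintro ⟨s, ⟨hs0, hst⟩, rfl⟩
    rw [mem_ofPred_eq]
    rcases hs0.eq_or_lt with rfl | hs
    · simp [movingPoint, (hG.pos _ t ht).le]
    · have hp := hG.pos (φ s) s hs
      simp only [movingPoint, if_pos hs]
      rw [norm_smul_unitVec hp.le, hG.radius_eq (coe_polarAngle_smul_unitVec hp (φ s))]
      exact hG.monotoneOn _ hs ht hst
  · intro hp
    rcases eq_or_ne p 0 with rfl | hp0
    · exact ⟨0, ⟨le_rfl, ht.le⟩, by simp [movingPoint]⟩
    · obtain ⟨s, hs0, hst, hus, hφ⟩ := hG.exists_time (norm_pos_iff.2 hp0) ht hp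
      refine ⟨s, ⟨hs0.le, hst⟩, ?_⟩
      rw [movingPoint, if_pos hs0, hG.radius_eq hφ, hus,
        apply_eq_of_coe_eq unitVec_add_two_pi hφ, norm_smul_unitVec_polarAngle]

lemma continuousAt_radius (hG : IsRadialGrowth u u' φ) {t : ℝ} (ht : 0 < t) {p : Plane}
    (hp : p ≠ 0) : ContinuousAt (fun q => u (polarAngle q) t) p := by
  have h : Continuous fun θ : Real.Angle => u θ.toReal t := by
    refine continuous_of_continuous_comp_coe ?_
    have : (fun x : ℝ => u (x : Real.Angle).toReal t) = fun x => u x t :=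
      funext fun x => hG.radius_eq (Real.Angle.coe_toReal _) t
    rw [this]
    exact (hG.contDiff t ht).continuous
  have h2 := h.continuousAt.comp (continuousAt_coe_polarAngle hp)
  refine h2.congr (Eventually.of_forall fun q => ?_)
  exact hG.radius_eq (Real.Angle.coe_toReal _) t

/-- The radius depends continuously on the point away from the origin, so the frontier of the
star-shaped footprint is its outer curve. -/
lemma frontier_eq (hG : IsRadialGrowth u u' φ) {t : ℝ} (ht : 0 < t) :
    frontier (footprint (movingPoint u φ) t) = {p | ‖p‖ = u (polarAngle p) t} := by
  rw [hG.footprint_movingPoint ht]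
  ext p
  rw [mem_ofPred_eq, frontier, Set.mem_sdiff, mem_interior_iff_mem_nhds]
  constructor
  · rintro ⟨hcl, hint⟩
    rcases eq_or_ne p 0 with rfl | hp0
    · refine absurd ?_ hint
      filter_upwards [Metric.ball_mem_nhds (0 : Plane) (half_pos ht)] with q hq
      rw [mem_ball_zero_iff] at hq
      linarith [hG.le_two_mul_self (polarAngle q) t ht]
    · have hc := hG.continuousAt_radius ht hp0
      rcases lt_trichotomy ‖p‖ (u (polarAngle p) t) with h | h | h
      · refine absurd ?_ hint
        filter_upwards [continuous_norm.continuousAt.eventually_lt hc h] with q hq using le_of_lt hq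
      · exact h
      · rw [mem_closure_iff_frequently] at hcl
        refine absurd hcl (not_frequently.2 ?_)
        filter_upwards [hc.eventually_lt continuous_norm.continuousAt h] with q hq using not_le.2 hq
  · intro h
    refine ⟨subset_closure h.le, fun hnhds => ?_⟩
    have hpos : 0 < ‖p‖ := h ▸ hG.pos _ t ht
    -- Points slightly beyond `p` on the ray through `p` lie outside the region.
    have hc : Tendsto (fun s : ℝ => s • p) (𝓝[>] 1) (𝓝 p) := by
      have : Tendsto (fun s : ℝ => s • p) (𝓝 1) (𝓝 ((1 : ℝ) • p)) :=
        (continuous_id.smul continuous_const).tendsto 1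
      rw [one_smul] at this
      exact this.mono_left nhdsWithin_le_nhds
    obtain ⟨s, hs, hs1⟩ := ((hc.eventually hnhds).and self_mem_nhdsWithin).exists
    have hs1' : 1 < s := hs1
    have hang : (polarAngle (s • p) : Real.Angle) = polarAngle p := by
      conv_lhs => rw [← norm_smul_unitVec_polarAngle p, smul_smul]
      exact coe_polarAngle_smul_unitVec (by positivity) _
    change ‖s • p‖ ≤ u (polarAngle (s • p)) t at hs
    rw [hG.radius_eq hang, ← h, norm_smul, Real.norm_of_nonneg (by linarith)] at hs
    nlinarith

lemma range_boundaryCurve (hG : IsRadialGrowth u u' φ) {t : ℝ} (ht : 0 < t) :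
    range (boundaryCurve u t) = frontier (footprint (movingPoint u φ) t) := by
  rw [hG.frontier_eq ht]
  ext p
  constructor
  · rintro ⟨θ, rfl⟩
    have hp := hG.pos θ.toReal t ht
    rw [mem_ofPred_eq, boundaryCurve, norm_smul_unitVec hp.le]
    exact (hG.radius_eq (coe_polarAngle_smul_unitVec hp _) t).symm
  · intro h
    refine ⟨(polarAngle p : Real.Angle), ?_⟩
    have := congrFun (hG.periodicLift_boundaryCurve t) (polarAngle p)
    rw [periodicLift] at this
    rw [this, ← show ‖p‖ = u (polarAngle p) t from h, norm_smul_unitVec_polarAngle]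

lemma movingPoint_mem_frontier (hG : IsRadialGrowth u u' φ) {t : ℝ} (ht : 0 < t) :
    movingPoint u φ t ∈ frontier (footprint (movingPoint u φ) t) := by
  rw [← hG.range_boundaryCurve ht]
  refine ⟨(φ t : Real.Angle), ?_⟩
  have := congrFun (hG.periodicLift_boundaryCurve t) (φ t)
  rw [periodicLift] at this
  rw [this, movingPoint, if_pos ht]

lemma isPeanoCurveOn_movingPoint (hG : IsRadialGrowth u u' φ) :
    IsPeanoCurveOn (Ici 0) (movingPoint u φ) where
  isInterval := ordConnected_Ici
  nondegenerate := ⟨0, le_refl (0 : ℝ), 1, zero_le_one' ℝ, zero_ne_one⟩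
  continuousOn := by
    intro t ht
    rcases (show (0 : ℝ) ≤ t from ht).eq_or_lt with rfl | ht
    · have h0 : movingPoint u φ 0 = 0 := by simp [movingPoint]
      rw [ContinuousWithinAt, h0]
      have hlim : Tendsto (fun s : ℝ => 2 * s) (𝓝[Ici 0] 0) (𝓝 0) := by
        have : Tendsto (fun s : ℝ => 2 * s) (𝓝 0) (𝓝 (2 * 0)) :=
          (continuous_const.mul continuous_id).tendsto 0
        rw [mul_zero] at this
        exact this.mono_left nhdsWithin_le_nhds
      refine squeeze_zero_norm' ?_ hlim
      filter_upwards [self_mem_nhdsWithin] with s hs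
      rcases (show (0 : ℝ) ≤ s from hs).eq_or_lt with rfl | hs
      · simp [h0]
      · rw [movingPoint, if_pos hs, norm_smul_unitVec (hG.pos _ _ hs).le]
        exact hG.le_two_mul _ _ hs
    · refine ContinuousAt.continuousWithinAt ?_
      have h1 : ContinuousOn (fun s => u (φ s) s) (Ioi 0) :=
        hG.continuousOn.comp (hG.continuousOn_angle.prodMk continuousOn_id)
          fun s hs => ⟨mem_univ _, hs⟩
      have h2 : ContinuousOn (fun s => u (φ s) s • unitVec (φ s)) (Ioi 0) :=
        h1.smul (continuous_unitVec.comp_continuousOn hG.continuousOn_angle)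
      refine (h2.continuousAt (Ioi_mem_nhds ht)).congr ?_
      filter_upwards [Ioi_mem_nhds ht] with s hs
      rw [movingPoint, if_pos (show 0 < s from hs)]
  interior_nonempty := by
    refine ⟨0, mem_interior.2 ⟨Metric.ball 0 (1 / 2), ?_, Metric.isOpen_ball, by simp⟩⟩
    refine Subset.trans (fun p hp => ?_)
      (image_mono (Icc_subset_Ici_self : Icc (0 : ℝ) 1 ⊆ Ici 0))
    change p ∈ footprint (movingPoint u φ) 1
    rw [hG.footprint_movingPoint one_pos, mem_ofPred_eq]
    rw [mem_ball_zero_iff] at hp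
    linarith [hG.le_two_mul_self (polarAngle p) 1 one_pos]

/-! ### The line field of a radial growth -/

lemma slope_add_two_pi (hG : IsRadialGrowth u u' φ) (θ : ℝ) {t : ℝ} (ht : 0 < t) :
    u' (θ + 2 * Real.pi) t = u' θ t := by
  have h1 := (hG.hasDerivAt (θ + 2 * Real.pi) t ht).comp_add_const θ (2 * Real.pi)
  simp only [hG.periodic] at h1
  exact h1.unique (hG.hasDerivAt θ t ht)

/-- Two curves of the family that meet are tangent to each other, because they do not cross. -/
lemma slope_eq_of_radius_eq (hG : IsRadialGrowth u u' φ) {θ s t : ℝ} (hs : 0 < s) (ht : 0 < t)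
    (h : u θ s = u θ t) : u' θ s = u' θ t := by
  wlog hst : s ≤ t generalizing s t
  · exact (this ht hs h.symm (le_of_not_ge hst)).symm
  have hd := (hG.hasDerivAt θ t ht).sub (hG.hasDerivAt θ s hs)
  have hmin : IsLocalMin (fun θ => u θ t - u θ s) θ := by
    refine Eventually.of_forall fun ψ => ?_
    simp only [h, sub_self]
    exact sub_nonneg.2 (hG.monotoneOn ψ hs ht hst)
  exact (sub_eq_zero.1 (hmin.hasDerivAt_eq_zero hd)).symm

/-- The velocity depends only on the point of the plane. -/
lemma velocity_eq (hG : IsRadialGrowth u u' φ) {a b s t : ℝ} (hs : 0 < s) (ht : 0 < t)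
    (h : u a s • unitVec a = u b t • unitVec b) : velocity u u' a s = velocity u u' b t := by
  have hn := congrArg norm h
  rw [norm_smul_unitVec (hG.pos _ _ hs).le, norm_smul_unitVec (hG.pos _ _ ht).le] at hn
  rw [hn] at h
  have hab := coe_eq_of_unitVec_eq (smul_right_injective Plane (hG.pos b t ht).ne' h)
  have hvel : velocity u u' a s = velocity u u' b s :=
    apply_eq_of_coe_eq (f := fun θ => velocity u u' θ s) (fun θ => by
      have : θ + 2 * Real.pi + Real.pi / 2 = θ + Real.pi / 2 + 2 * Real.pi := by ring
      simp only [velocity, hG.slope_add_two_pi θ hs, hG.periodic, unitVec_add_two_pi, this]) hab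
  have hu : u b s = u b t := by rw [← hG.radius_eq hab, hn]
  rw [hvel, velocity, velocity, hG.slope_eq_of_radius_eq hs ht hu, hu]

lemma exists_coordinates (hG : IsRadialGrowth u u' φ) {p : Plane} (hp : p ≠ 0) :
    ∃ q : ℝ × ℝ, q.1 ∈ Icc (-Real.pi) Real.pi ∧ 0 < q.2 ∧ u q.1 q.2 • unitVec q.1 = p := by
  have hn := norm_pos_iff.2 hp
  obtain ⟨s, hs0, -, hus, -⟩ := hG.exists_time (θ := polarAngle p) (t := 2 * ‖p‖) hn
    (by positivity) (by linarith [hG.le_two_mul_self (polarAngle p) (2 * ‖p‖) (by positivity)])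
  refine ⟨(polarAngle p, s), ⟨(Complex.neg_pi_lt_arg _).le, Complex.arg_le_pi _⟩, hs0, ?_⟩
  simp only [hus, norm_smul_unitVec_polarAngle]

open Classical in
/-- A vector field tangent to all curves of the family: the common velocity of the curves through
a point of the punctured plane. -/
noncomputable def tangentField (u u' : ℝ → ℝ → ℝ) (p : Plane) : Plane :=
  if h : ∃ q : ℝ × ℝ, q.1 ∈ Icc (-Real.pi) Real.pi ∧ 0 < q.2 ∧ u q.1 q.2 • unitVec q.1 = p then
    velocity u u' h.choose.1 h.choose.2 else 0

lemma tangentField_smul_unitVec (hG : IsRadialGrowth u u' φ) (θ : ℝ) {t : ℝ} (ht : 0 < t) :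
    tangentField u u' (u θ t • unitVec θ) = velocity u u' θ t := by
  have hne : u θ t • unitVec θ ≠ 0 := by
    rw [← norm_pos_iff, norm_smul_unitVec (hG.pos θ t ht).le]; exact hG.pos θ t ht
  have h := hG.exists_coordinates hne
  rw [tangentField, dif_pos h]
  exact hG.velocity_eq h.choose_spec.2.1 ht h.choose_spec.2.2

end IsRadialGrowth

/-- A function is continuous on the image of a compact set under a continuous map if its
composition with that map is continuous. -/
lemma IsCompact.continuousOn_image {X Y Z : Type*} [TopologicalSpace X] [TopologicalSpace Y]
    [TopologicalSpace Z] [T2Space Y] {K : Set X} (hK : IsCompact K) {f : X → Y} {w : Y → Z}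
    (hf : ContinuousOn f K) (hw : ContinuousOn (w ∘ f) K) : ContinuousOn w (f '' K) := by
  rw [continuousOn_iff_isClosed]
  intro C hC
  obtain ⟨D, hD, hDK⟩ := continuousOn_iff_isClosed.1 hw C hC
  refine ⟨f '' (D ∩ K), ?_, ?_⟩
  · refine IsCompact.isClosed ?_
    exact (hK.inter_left hD).image_of_continuousOn (hf.mono inter_subset_right)
  · ext y
    constructor
    · rintro ⟨hy, x, hx, rfl⟩
      have : x ∈ D ∩ K := hDK ▸ ⟨hy, hx⟩
      exact ⟨⟨x, this, rfl⟩, ⟨x, hx, rfl⟩⟩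
    · rintro ⟨⟨x, hx, rfl⟩, hy⟩
      rw [← hDK] at hx
      exact ⟨hx.1, hy⟩

namespace IsRadialGrowth

variable {u u' : ℝ → ℝ → ℝ} {φ : ℝ → ℝ}

lemma isContinuousLineFieldOn (hG : IsRadialGrowth u u' φ) :
    IsContinuousLineFieldOn {0}ᶜ fun p => Submodule.span ℝ {tangentField u u' p} := by
  intro p hp
  have hr : 0 < ‖p‖ := norm_pos_iff.2 hp
  set r := ‖p‖ with hrdef
  set V : Set Plane := {q | r / 2 < ‖q‖ ∧ ‖q‖ < 2 * r}
  have hVo : IsOpen V := (isOpen_lt continuous_const continuous_norm).inter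
    (isOpen_lt continuous_norm continuous_const)
  refine ⟨V, hVo, ⟨by linarith, by linarith⟩, tangentField u u', ?_, fun q hq => ⟨?_, rfl⟩⟩
  · set K : Set (ℝ × ℝ) := Icc (-Real.pi) Real.pi ×ˢ Icc (r / 4) (4 * r)
    have hK : IsCompact K := isCompact_Icc.prod isCompact_Icc
    have hKpos : ∀ q ∈ K, 0 < q.2 := fun q hq => by linarith [hq.2.1]
    have hKsub : K ⊆ univ ×ˢ Ioi 0 := fun q hq => ⟨mem_univ _, hKpos q hq⟩
    have hu := hG.continuousOn.mono hKsub
    have hu' := hG.continuousOn_deriv.mono hKsub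
    have hcont := continuous_unitVec
    have he : ContinuousOn (fun q : ℝ × ℝ => unitVec q.1) K := by fun_prop
    have he' : ContinuousOn (fun q : ℝ × ℝ => unitVec (q.1 + Real.pi / 2)) K := by fun_prop
    refine (hK.continuousOn_image (f := fun q => u q.1 q.2 • unitVec q.1) (hu.smul he) ?_).mono ?_
    · refine ((hu'.smul he).add (hu.smul he')).congr fun q hq => ?_
      exact hG.tangentField_smul_unitVec q.1 (hKpos q hq)
    · rintro q ⟨hq, hq0⟩
      obtain ⟨c, hc1, hc2, hc3⟩ := hG.exists_coordinates hq0
      have hcn := congrArg norm hc3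
      rw [norm_smul_unitVec (hG.pos _ _ hc2).le] at hcn
      refine ⟨c, ⟨hc1, ?_, ?_⟩, hc3⟩
      · linarith [hG.le_two_mul c.1 c.2 hc2, hq.1]
      · linarith [hG.le_two_mul_self c.1 c.2 hc2, hq.2]
  · obtain ⟨c, -, hc2, hc3⟩ := hG.exists_coordinates hq.2
    rw [← hc3, hG.tangentField_smul_unitVec c.1 hc2]
    exact smul_unitVec_add_ne_zero _ (hG.pos _ _ hc2).ne' _

lemma movingPoint_zero : movingPoint u φ 0 = 0 := by simp [movingPoint]

lemma parametrizesTangentCurve (hG : IsRadialGrowth u u' φ) {t : ℝ} (ht : 0 < t) :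
    ParametrizesTangentCurve (movingPoint u φ 0)
      (fun p => Submodule.span ℝ {tangentField u u' p})
      (frontier (footprint (movingPoint u φ) t)) (boundaryCurve u t) where
  isSmoothCircleEmbedding := hG.isSmoothCircleEmbedding ht
  range_eq := hG.range_boundaryCurve ht
  ne_puncture θ := by
    rw [movingPoint_zero, ← norm_pos_iff, boundaryCurve, norm_smul_unitVec (hG.pos _ _ ht).le]
    exact hG.pos _ _ ht
  tangent x := by
    rw [(hG.hasDerivAt_boundaryCurve ht x).deriv, hG.periodicLift_boundaryCurve]
    simp only [hG.tangentField_smul_unitVec x ht]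

end IsRadialGrowth

/-! ### Closeness to circles -/

lemma iteratedDeriv_unitVec (k : ℕ) :
    iteratedDeriv k unitVec = fun x => unitVec (x + k * (Real.pi / 2)) := by
  induction k with
  | zero => simp
  | succ k ih =>
    rw [iteratedDeriv_succ, ih]
    ext1 x
    rw [deriv_comp_add_const, (hasDerivAt_unitVec _).deriv]
    congr 1; push_cast; ring

lemma abs_cantorTime_sub_le (y : ℝ) : |cantorTime y - y| ≤ 1 := by
  have h1 := monotone_cantorTime (Int.floor_le y)
  have h2 := monotone_cantorTime (Int.lt_floor_add_one y).le
  have h3 := cantorTime_intCast (⌊y⌋ + 1)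
  push_cast at h3
  rw [cantorTime_intCast] at h1
  rw [h3] at h2
  rw [abs_le]
  constructor <;> linarith [Int.floor_le y, Int.lt_floor_add_one y]

/-- The derivatives of each order of the model curves are bounded uniformly in time, relative to
the circles that they perturb. -/
lemma exists_norm_iteratedFDeriv_model_le : ∃ B : ℕ → ℝ, ∀ (k : ℕ) (y x : ℝ),
    ‖iteratedFDeriv ℝ k (fun x => (modelHeight x y - y) • unitVec x) x‖ ≤ B k := by
  obtain ⟨E, hE⟩ := exists_norm_iteratedFDeriv_densityWave_le
  refine ⟨fun k => ∑ i ∈ Finset.range (k + 1), (k.choose i : ℝ) * (1 + E i) * 1, fun k y x => ?_⟩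
  have hcd : ContDiff ℝ ∞ fun x => modelHeight x y - y :=
    (contDiff_modelHeight y).sub contDiff_const
  refine (norm_iteratedFDeriv_smul_le hcd contDiff_unitVec x
    (by exact_mod_cast le_top)).trans ?_
  refine Finset.sum_le_sum fun i _ => ?_
  have h1 : ‖iteratedFDeriv ℝ i (fun x => modelHeight x y - y) x‖ ≤ 1 + E i := by
    have e : (fun x => modelHeight x y - y) =
        (fun _ => cantorTime y - y) + fun x => densityWave x (cantorTime y) := by
      ext x; simp only [modelHeight, occupationDensity, Pi.add_apply]; ring
    rw [e, iteratedFDeriv_add_apply contDiff_const.contDiffAt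
      ((contDiff_densityWave _).of_le (by exact_mod_cast le_top)).contDiffAt]
    refine (norm_add_le _ _).trans (add_le_add ?_ (hE i x _))
    rcases Nat.eq_zero_or_pos i with rfl | hi
    · rw [norm_iteratedFDeriv_zero]; exact abs_cantorTime_sub_le y
    · rw [iteratedFDeriv_const_of_ne hi.ne']; simp
  have h2 : ‖iteratedFDeriv ℝ (k - i) unitVec x‖ ≤ 1 := by
    rw [norm_iteratedFDeriv_eq_norm_iteratedDeriv, iteratedDeriv_unitVec, norm_unitVec]
  have h3 : 0 ≤ 1 + E i := (norm_nonneg _).trans h1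
  gcongr

lemma periodicLift_circleParam (t : ℝ) : periodicLift (circleParam t) = fun x => t • unitVec x := by
  ext x i
  fin_cases i <;> simp [periodicLift, circleParam, unitVec]

/-- The gauge for the layers is `ε t / N (k t)`, where `N n` bounds the derivatives of order at most
`n` of the model curves; semicontinuity bounds it below locally. -/
lemma exists_peanoCurve (k : ℝ → ℕ) (ε : ℝ → ℝ) (hk : UpperSemicontinuousOn k (Ioi 0))
    (hε : LowerSemicontinuousOn ε (Ioi 0)) (hpos : ∀ t : ℝ, 0 < t → 0 < ε t) :
    ∃ (γ : ℝ → Plane) (Λ : Plane → Submodule ℝ Plane),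
      IsPeanoCurveOn (Ici 0) γ ∧
      IsContinuousLineFieldOn {γ 0}ᶜ Λ ∧
      ∀ t : ℝ, 0 < t →
        γ t ∈ frontier (footprint γ t) ∧
        ∃ β : Real.Angle → Plane,
          ParametrizesTangentCurve (γ 0) Λ (frontier (footprint γ t)) β ∧
          ckNorm (k t) (fun θ => β θ - circleParam t θ) < ε t := by
  obtain ⟨B, hB⟩ := exists_norm_iteratedFDeriv_model_le
  have hB0 : ∀ j, 0 ≤ B j := fun j => (norm_nonneg _).trans (hB j 0 0)
  let N : ℕ → ℝ := fun n => 1 + ∑ j ∈ Finset.range (n + 1), B j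
  have hN1 : ∀ n, 1 ≤ N n := fun n =>
    le_add_of_nonneg_right (Finset.sum_nonneg fun j _ => hB0 j)
  have hNB : ∀ n j, j ∈ Finset.range (n + 1) → B j ≤ N n := fun n j hj => by
    have := Finset.single_le_sum (fun i _ => hB0 i) hj
    simp only [N]; linarith
  have hNmono : Monotone N := fun a b hab => by
    have : ∑ j ∈ Finset.range (a + 1), B j ≤ ∑ j ∈ Finset.range (b + 1), B j :=
      Finset.sum_le_sum_of_subset_of_nonneg (Finset.range_mono (by omega)) fun i _ _ => hB0 i
    simp only [N]; linarith
  have hm : ∀ s, 0 < s → ∃ η > 0, ∀ᶠ r in 𝓝 s, η ≤ ε r / N (k r) := by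
    intro s hs
    have hs0 := hpos s hs
    have hNs : 0 < N (k s) := one_pos.trans_le (hN1 _)
    refine ⟨ε s / 2 / N (k s), by positivity, ?_⟩
    have h1 := hk s hs (k s + 1) (Nat.lt_succ_self _)
    have h2 := hε s hs (ε s / 2) (half_lt_self hs0)
    rw [nhdsWithin_eq_nhds.2 (Ioi_mem_nhds hs)] at h1 h2
    filter_upwards [h1, h2] with r hr1 hr2
    exact div_le_div₀ ((half_pos hs0).trans hr2).le hr2.le (one_pos.trans_le (hN1 _))
      (hNmono (Nat.lt_succ_iff.1 hr1))
  obtain ⟨u, u', φ, hG, hclose⟩ := exists_isRadialGrowth hm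
  refine ⟨IsRadialGrowth.movingPoint u φ,
    fun p => Submodule.span ℝ {IsRadialGrowth.tangentField u u' p},
    hG.isPeanoCurveOn_movingPoint, ?_, fun t ht => ⟨hG.movingPoint_mem_frontier ht,
      IsRadialGrowth.boundaryCurve u t, hG.parametrizesTangentCurve ht, ?_⟩⟩
  · rw [IsRadialGrowth.movingPoint_zero]
    exact hG.isContinuousLineFieldOn
  · obtain ⟨h, y, h0, hlt, heq⟩ := hclose t ht
    have hlift : periodicLift (fun θ => IsRadialGrowth.boundaryCurve u t θ - circleParam t θ) =
        h • fun x => (modelHeight x y - y) • unitVec x := by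
      ext1 x
      have h1 := congrFun (hG.periodicLift_boundaryCurve t) x
      have h2 := congrFun (periodicLift_circleParam t) x
      simp only [periodicLift] at h1 h2 ⊢
      rw [h1, h2, ← sub_smul, heq, mul_smul]
      rfl
    have hNk : 0 < N (k t) := one_pos.trans_le (hN1 _)
    rw [lt_div_iff₀ hNk] at hlt
    rw [ckNorm, Finset.sup'_lt_iff]
    intro j hj
    refine lt_of_le_of_lt (ciSup_le fun x => ?_) hlt
    have hcd : ContDiff ℝ ∞ fun x => (modelHeight x y - y) • unitVec x :=
      ((contDiff_modelHeight y).sub contDiff_const).smul contDiff_unitVec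
    rw [hlift, ← norm_iteratedFDeriv_eq_norm_iteratedDeriv, iteratedFDeriv_const_smul_apply
      (hcd.of_le (by exact_mod_cast le_top)).contDiffAt, norm_smul, Real.norm_of_nonneg h0]
    exact mul_le_mul_of_nonneg_left ((hB j y x).trans (hNB _ j hj)) h0

theorem mainTheorem1 :
    (∃ (γ : ℝ → Plane) (Λ : Plane → Submodule ℝ Plane),
      IsPeanoCurveOn (Ici 0) γ ∧
      IsContinuousLineFieldOn {γ 0}ᶜ Λ ∧
      ∀ t : ℝ, 0 < t →
        γ t ∈ frontier (footprint γ t) ∧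
        ∃ β : Real.Angle → Plane,
          ParametrizesTangentCurve (γ 0) Λ (frontier (footprint γ t)) β) ∧
    (∀ (k : ℝ → ℕ) (ε : ℝ → ℝ),
      UpperSemicontinuousOn k (Ioi 0) →
      LowerSemicontinuousOn ε (Ioi 0) →
      (∀ t : ℝ, 0 < t → 0 < ε t) →
      ∃ (γ : ℝ → Plane) (Λ : Plane → Submodule ℝ Plane),
        IsPeanoCurveOn (Ici 0) γ ∧
        IsContinuousLineFieldOn {γ 0}ᶜ Λ ∧
        ∀ t : ℝ, 0 < t →
          γ t ∈ frontier (footprint γ t) ∧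
          ∃ β : Real.Angle → Plane,
            ParametrizesTangentCurve (γ 0) Λ (frontier (footprint γ t)) β ∧
            ckNorm (k t) (fun θ => β θ - circleParam t θ) < ε t) := by
  refine ⟨?_, exists_peanoCurve⟩
  obtain ⟨γ, Λ, hγ, hΛ, h⟩ := exists_peanoCurve (fun _ => 0) (fun _ => 1)
    upperSemicontinuousOn_const lowerSemicontinuousOn_const fun _ _ => one_pos
  refine ⟨γ, Λ, hγ, hΛ, fun t ht => ⟨(h t ht).1, ?_⟩⟩
  obtain ⟨β, hβ, -⟩ := (h t ht).2
  exact ⟨β, hβ⟩
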